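/- Let $m\in\mathbb N$ and consider bounded operators on $\ell^2(\mathbb Z^2;\mathbb C^m)$. For $S\subset\mathbb R^2$ let $\Lambda_S$ be multiplication by the characteristic function of $S$ (restricted to $\mathbb Z^2\subset\mathbb R^2$) and $\Lambda_S^\perp=1-\Lambda_S$. A bounded operator $A$ with kernel $A_{xy}\in\mathbb C^{m\times m}$ is *local* if there is $\nu>0$ with $\|A_{xy}\|\le \nu^{-1}e^{-\nu\|x-y\|}$ for all $x,y\in\mathbb Z^2$. Two sets $U,V\subset\mathbb R^2$ are *transverse* if $$\liminf_{\|x\|\to\infty}\frac{\log\bigl(1+d(x,\partial U)+d(x,\partial V)\bigr)}{\log\|x\|}>0 ,$$ where $d$ is the Euclidean distance and $d(x,\emptyset)=+\infty$. Let $U,V\subset\mathbb R^2$ be transverse and let $P$ be either an arbitrary local orthogonal projection, or the Fermi projection $P=\chi_{(-\infty,E_F)}(H)$ of a local bounded self-adjoint operator $H$ with $E_F\in\mathbb R\setminus\mathrm{Spec}(H)$. Then the operator $\Lambda_V e^{2\pi i\Lambda_U P\Lambda_U}\Lambda_V+\Lambda_V^\perp$ is Fredholm, the operator $P[[\Lambda_U,P],[\Lambda_V,P]]$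 is trace class, and $$\mathrm{ind}\bigl(\Lambda_V e^{2\pi i\Lambda_U P\Lambda_U}\Lambda_V+\Lambda_V^\perp\bigr)=2\pi\cdot i\,\mathrm{Tr}\bigl(P[[\Lambda_U,P],[\Lambda_V,P]]\bigr),$$ where $\mathrm{ind}=\dim\ker-\dim\mathrm{coker}$. That is, the geometric Kitaev index $\mathcal N^{U,V}(H)$ equals $2\pi$ times the geometric Hall conductance $\sigma^{U,V}_{\rm Hall}(H)$. -/

import Mathlib

open scoped InnerProductSpace

noncomputable section

namespace GeometricHall

/-! ### Transverse subsets of the plane -/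

/-- The Euclidean plane `ℝ²`. -/
abbrev Plane : Type := EuclideanSpace ℝ (Fin 2)

/-- `Ψ_{U,V}(x) = 1 + d(x, ∂U) + d(x, ∂V)`, with Euclidean distances and the convention
`d(x, ∅) = +∞`. -/
def Psi (U V : Set Plane) (x : Plane) : ENNReal :=
  1 + Metric.infEDist x (frontier U) + Metric.infEDist x (frontier V)

/-- `U` and `V` are transverse if `liminf_{‖x‖ → ∞} log Ψ_{U,V}(x) / log ‖x‖ > 0`
(a lower limit in the extended real numbers). -/
def AreTransverse (U V : Set Plane) : Prop :=
  0 < Filter.liminf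
    (fun x : Plane => ENNReal.log (Psi U V x) / ((Real.log ‖x‖ : ℝ) : EReal))
    (Bornology.cobounded Plane)

/-! ### Operators on `ℓ²(ℤ²; ℂᵐ)` -/

/-- The Hilbert space `ℓ²(ℤ²; ℂᵐ)`. -/
abbrev Hilb (m : ℕ) : Type := lp (fun _ : ℤ × ℤ => EuclideanSpace ℂ (Fin m)) 2

/-- Bounded operators on `ℓ²(ℤ²; ℂᵐ)`. -/
abbrev Op (m : ℕ) : Type := Hilb m →L[ℂ] Hilb m

/-- The inclusion `ℤ² ⊆ ℝ²`. -/
def latticePoint (x : ℤ × ℤ) : Plane := !₂[(x.1 : ℝ), (x.2 : ℝ)]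

/-- The kernel `A_{xy} : ℂᵐ → ℂᵐ` of a bounded operator `A`: `A_{xy} v = (A (δ_y ⊗ v))(x)`. -/
def kernel {m : ℕ} (A : Op m) (x y : ℤ × ℤ) :
    EuclideanSpace ℂ (Fin m) →L[ℂ] EuclideanSpace ℂ (Fin m) :=
  lp.evalCLM ℂ (fun _ : ℤ × ℤ => EuclideanSpace ℂ (Fin m)) 2 x ∘L A ∘L
    lp.singleContinuousLinearMap ℂ (fun _ : ℤ × ℤ => EuclideanSpace ℂ (Fin m)) 2 y

/-- `A` is local: `‖A_{xy}‖ ≤ ν⁻¹ e^{-ν ‖x - y‖}` for some `ν > 0`. -/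
def IsLocal {m : ℕ} (A : Op m) : Prop :=
  ∃ ν : ℝ, 0 < ν ∧ ∀ x y : ℤ × ℤ,
    ‖kernel A x y‖ ≤ ν⁻¹ * Real.exp (-ν * ‖latticePoint x - latticePoint y‖)

open Classical in
/-- `Λ_S = χ_S(X)`: multiplication by the characteristic function of `S ⊆ ℝ²`. -/
def Lam (m : ℕ) (S : Set Plane) : Op m :=
  lp.mapCLM 2
    (fun x : ℤ × ℤ => if latticePoint x ∈ S then
      ContinuousLinearMap.id ℂ (EuclideanSpace ℂ (Fin m)) else 0)
    (zero_le_one' ℝ)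
    (fun x => by
      split_ifs
      · exact ContinuousLinearMap.norm_id_le
      · simp)

/-! ### Trace class operators on a Hilbert space -/

/-- `A` is trace class: `Tr |A| < ∞`. -/
def IsTraceClass {E : Type} [NormedAddCommGroup E] [InnerProductSpace ℂ E] [CompleteSpace E]
    (A : E →L[ℂ] E) : Prop :=
  ∀ (ι : Type) (b : HilbertBasis ι ℂ E), Summable fun i => ‖⟪b i, CFC.abs A (b i)⟫_ℂ‖

/-- The trace of a (trace class) operator, `∑ ⟨b_i, A b_i⟩` over an orthonormal basis. -/
def trace {E : Type} [NormedAddCommGroup E] [InnerProductSpace ℂ E] [CompleteSpace E]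
    (A : E →L[ℂ] E) : ℂ :=
  let b := (exists_hilbertBasis ℂ E).choose_spec.choose
  ∑' i, ⟪b i, A (b i)⟫_ℂ

/-! ### Fermi projections -/

/-- The Fermi projection `χ_{(-∞, E_F)}(H)` of a bounded self-adjoint operator `H` with
`E_F ∉ Spec H`, by continuous functional calculus (the function is continuous on `Spec H`). -/
def fermiProjection {E : Type} [NormedAddCommGroup E] [InnerProductSpace ℂ E] [CompleteSpace E]
    (H : E →L[ℂ] E) (EF : ℝ) : E →L[ℂ] E :=
  cfc (Set.indicator (Set.Iio EF) (fun _ : ℝ => (1 : ℝ))) H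

/-! ### The geometric Kitaev index and the geometric Hall conductance -/

/-- The operator `Λ_V exp(2πi Λ_U P Λ_U) Λ_V + Λ_V^⊥`. -/
def kitaevOp {m : ℕ} (P : Op m) (U V : Set Plane) : Op m :=
  Lam m V * NormedSpace.exp ((2 * Real.pi * Complex.I : ℂ) • (Lam m U * P * Lam m U)) * Lam m V
    + (1 - Lam m V)

/-- The geometric Kitaev index: the Fredholm index `dim ker - dim coker` of `kitaevOp`. -/
def kitaevIndex {m : ℕ} (P : Op m) (U V : Set Plane) : ℤ :=
  (kitaevOp P U V : Hilb m →ₗ[ℂ] Hilb m).index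

/-- The operator `P [[Λ_U, P], [Λ_V, P]]`. -/
def hallOp {m : ℕ} (P : Op m) (U V : Set Plane) : Op m :=
  P * ⁅⁅Lam m U, P⁆, ⁅Lam m V, P⁆⁆

/-- The geometric Hall conductance `i Tr (P [[Λ_U, P], [Λ_V, P]])`. -/
def hallConductance {m : ℕ} (P : Op m) (U V : Set Plane) : ℂ :=
  Complex.I * trace (hallOp P U V)

end GeometricHall

end

/-! Write c = Λ_U, l = Λ_V, p = P, A = cpc, z = 2πi, u = e^{zA}. The analytic input is that
[c,p][l,p] and [l,p][c,p] are nuclear. By locality, the column of [Λ_W,P] at a lattice point y is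
exponentially small in the distance from y to ∂W, and transversality makes one of the two distances
at least a power of ‖y‖ (`nuclearTriple_of_isLocal`). The rest of the index theorem is algebra with
traces.

Since e^z = 1, u - 1 is a series in A^{n+1} - A, hence vanishes to the extent that A is idempotent,
and [u,l] is nuclear although [A,l] need not be. So lul + (1-l) has the parametrix l u⁻¹ l + (1-l),
and Fedosov's formula (`index_eq_trace_sub_trace`) gives the index as Tr([u,l]u⁻¹).

To evaluate this trace, a nuclear commutator with a projection is traceless, so u⁻¹ may be replaced
by u⁻¹ - 1. Differentiating the exponential under the trace gives -z Tr([A,l](u - 1)). With B = pcp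
and M = plp, cyclicity reduces each term to Tr([B,M]B^k) = Tr[B,M]/(k+1), so that Tr([A,l](A^{n+1} -
A)) = (1/(n+2) - 1/2) Tr[B,M] (`trace_commutator_cpc_mul_pow_sub`). Summing against the exponential
coefficients gives -Tr[B,M], and [B,M] = p[[c,p],[l,p]]p. The index is therefore z
Tr(p[[c,p],[l,p]]).

For a Fermi projection only locality is missing. It follows by a Combes–Thomas argument: conjugation
by slowly varying exponential weights moves H little, and polynomials converging to the spectral
projection stay bounded under this change (`exists_norm_conj_fermiProjection_le`). -/

noncomputable section

namespace GeometricHall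

/-! ### Nuclear operators on a Hilbert space -/

section Nuclear

variable {E : Type} [NormedAddCommGroup E] [InnerProductSpace ℂ E]

/-- `A = ∑ᵢ |aᵢ⟩⟨bᵢ|` with `∑ᵢ ‖aᵢ‖ ‖bᵢ‖ < ∞`. -/
structure IsNuclearRep {ι : Type} (A : E →L[ℂ] E) (a b : ι → E) : Prop where
  summable : Summable fun i => ‖a i‖ * ‖b i‖
  hasSum : ∀ x, HasSum (fun i => ⟪b i, x⟫_ℂ • a i) (A x)

/-- `A` has nuclear norm at most `C`. -/
def NuclearBound (A : E →L[ℂ] E) (C : ℝ) : Prop :=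
  ∃ (ι : Type) (a b : ι → E), IsNuclearRep A a b ∧ ∑' i, ‖a i‖ * ‖b i‖ ≤ C

/-- `A` is a nuclear operator. -/
def IsNuclear (A : E →L[ℂ] E) : Prop := ∃ C, NuclearBound A C

theorem NuclearBound.isNuclear {A : E →L[ℂ] E} {C : ℝ} (h : NuclearBound A C) : IsNuclear A :=
  ⟨C, h⟩

theorem IsNuclearRep.isNuclear {ι : Type} {A : E →L[ℂ] E} {a b : ι → E}
    (h : IsNuclearRep A a b) : IsNuclear A := ⟨_, ι, a, b, h, le_rfl⟩

theorem NuclearBound.mono {A : E →L[ℂ] E} {C C' : ℝ} (h : NuclearBound A C) (hC : C ≤ C') :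
    NuclearBound A C' := by
  obtain ⟨ι, a, b, h, h'⟩ := h
  exact ⟨ι, a, b, h, h'.trans hC⟩

theorem NuclearBound.nonneg {A : E →L[ℂ] E} {C : ℝ} (h : NuclearBound A C) : 0 ≤ C := by
  obtain ⟨ι, a, b, h, h'⟩ := h
  exact (tsum_nonneg fun i => by positivity).trans h'

theorem IsNuclearRep.add {ι κ : Type} {A B : E →L[ℂ] E} {a b : ι → E} {a' b' : κ → E}
    (hA : IsNuclearRep A a b) (hB : IsNuclearRep B a' b') :
    IsNuclearRep (A + B) (Sum.elim a a') (Sum.elim b b') where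
  summable := by
    have := HasSum.sum (f := fun i => ‖Sum.elim a a' i‖ * ‖Sum.elim b b' i‖)
      hA.summable.hasSum hB.summable.hasSum
    exact this.summable
  hasSum x := by
    have := HasSum.sum (f := fun i => ⟪Sum.elim b b' i, x⟫_ℂ • Sum.elim a a' i)
      (hA.hasSum x) (hB.hasSum x)
    exact this

theorem NuclearBound.add {A B : E →L[ℂ] E} {C D : ℝ} (hA : NuclearBound A C)
    (hB : NuclearBound B D) : NuclearBound (A + B) (C + D) := by
  obtain ⟨ι, a, b, h, h'⟩ := hA
  obtain ⟨κ, a', b', k, k'⟩ := hB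
  refine ⟨ι ⊕ κ, _, _, h.add k, ?_⟩
  have := HasSum.sum (f := fun i => ‖Sum.elim a a' i‖ * ‖Sum.elim b b' i‖)
    h.summable.hasSum k.summable.hasSum
  rw [this.tsum_eq]
  linarith

theorem NuclearBound.neg {A : E →L[ℂ] E} {C : ℝ} (hA : NuclearBound A C) :
    NuclearBound (-A) C := by
  obtain ⟨ι, a, b, h, h'⟩ := hA
  refine ⟨ι, fun i => - a i, b, ⟨by simpa using h.summable, fun x => ?_⟩, by simpa using h'⟩
  simpa using (h.hasSum x).neg

theorem NuclearBound.sub {A B : E →L[ℂ] E} {C D : ℝ} (hA : NuclearBound A C)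
    (hB : NuclearBound B D) : NuclearBound (A - B) (C + D) := by
  rw [sub_eq_add_neg]
  exact hA.add hB.neg

theorem NuclearBound.zero : NuclearBound (0 : E →L[ℂ] E) 0 :=
  ⟨Empty, Empty.elim, Empty.elim, ⟨summable_empty, fun x => by simp⟩, by simp⟩

theorem IsNuclearRep.mul_left {ι : Type} {A : E →L[ℂ] E} {a b : ι → E} (h : IsNuclearRep A a b)
    (T : E →L[ℂ] E) : IsNuclearRep (T * A) (fun i => T (a i)) b where
  summable := by
    refine Summable.of_nonneg_of_le (fun i => by positivity) (fun i => ?_)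
      (h.summable.mul_left ‖T‖)
    rw [← mul_assoc]
    gcongr
    exact T.le_opNorm _
  hasSum x := by simpa using T.hasSum (h.hasSum x)

theorem NuclearBound.mul_left {A : E →L[ℂ] E} {C : ℝ} (hA : NuclearBound A C) (T : E →L[ℂ] E) :
    NuclearBound (T * A) (‖T‖ * C) := by
  obtain ⟨ι, a, b, h, h'⟩ := hA
  refine ⟨ι, _, _, h.mul_left T, ?_⟩
  calc ∑' i, ‖T (a i)‖ * ‖b i‖ ≤ ∑' i, ‖T‖ * (‖a i‖ * ‖b i‖) := by
        refine (h.mul_left T).summable.tsum_le_tsum (fun i => ?_) (h.summable.mul_left _)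
        rw [← mul_assoc]
        gcongr
        exact T.le_opNorm _
    _ ≤ ‖T‖ * C := by rw [tsum_mul_left]; gcongr

theorem NuclearBound.smul {A : E →L[ℂ] E} {C : ℝ} (hA : NuclearBound A C) (z : ℂ) :
    NuclearBound (z • A) (‖z‖ * C) := by
  obtain ⟨ι, a, b, h, h'⟩ := hA
  refine ⟨ι, fun i => z • a i, b, ⟨?_, fun x => ?_⟩, ?_⟩
  · simpa [norm_smul, mul_assoc] using h.summable.mul_left ‖z‖
  · simpa [smul_comm z] using (h.hasSum x).const_smul z
  · simp only [norm_smul, mul_assoc, tsum_mul_left]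
    gcongr

/-- Termwise representation of a series of nuclear operators. -/
theorem IsNuclearRep.sigma {Y : ℕ → E →L[ℂ] E} {Z : E →L[ℂ] E} {ι : ℕ → Type}
    {a b : (n : ℕ) → ι n → E} (h : ∀ n, IsNuclearRep (Y n) (a n) (b n)) {C : ℕ → ℝ}
    (hC : ∀ n, ∑' i, ‖a n i‖ * ‖b n i‖ ≤ C n) (hs : Summable C)
    (hZ : ∀ x, HasSum (fun n => Y n x) (Z x)) [CompleteSpace E] :
    IsNuclearRep Z (fun p : Σ n, ι n => a p.1 p.2) (fun p => b p.1 p.2) := by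
  have hsum : Summable fun p : Σ n, ι n => ‖a p.1 p.2‖ * ‖b p.1 p.2‖ := by
    refine (summable_sigma_of_nonneg (fun p => by positivity)).2
      ⟨fun n => (h n).summable, ?_⟩
    exact Summable.of_nonneg_of_le (fun n => tsum_nonneg fun i => by positivity) hC hs
  refine ⟨hsum, fun x => ?_⟩
  have hsx : Summable fun p : Σ n, ι n => ⟪b p.1 p.2, x⟫_ℂ • a p.1 p.2 := by
    refine Summable.of_norm_bounded (hsum.mul_right ‖x‖) fun p => ?_
    rw [norm_smul]
    calc ‖⟪b p.1 p.2, x⟫_ℂ‖ * ‖a p.1 p.2‖ ≤ (‖b p.1 p.2‖ * ‖x‖) * ‖a p.1 p.2‖ := by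
          gcongr; exact norm_inner_le_norm _ _
      _ = _ := by ring
  have := hsx.hasSum.sigma fun n => (h n).hasSum x
  rw [← this.unique (hZ x)]
  exact hsx.hasSum

theorem IsNuclear.add {A B : E →L[ℂ] E} (hA : IsNuclear A) (hB : IsNuclear B) :
    IsNuclear (A + B) := ⟨_, hA.choose_spec.add hB.choose_spec⟩

theorem IsNuclear.sub {A B : E →L[ℂ] E} (hA : IsNuclear A) (hB : IsNuclear B) :
    IsNuclear (A - B) := ⟨_, hA.choose_spec.sub hB.choose_spec⟩

theorem IsNuclear.neg {A : E →L[ℂ] E} (hA : IsNuclear A) : IsNuclear (-A) :=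
  ⟨_, hA.choose_spec.neg⟩

theorem IsNuclear.mul_left {A : E →L[ℂ] E} (hA : IsNuclear A) (T : E →L[ℂ] E) :
    IsNuclear (T * A) := ⟨_, hA.choose_spec.mul_left T⟩

/-- Cauchy–Schwarz in ℓ² followed by Bessel's inequality for each factor. -/
theorem summable_norm_inner_mul_inner_le {κ : Type} {e : κ → E} (he : Orthonormal ℂ e)
    (a b : E) : Summable (fun k => ‖⟪b, e k⟫_ℂ‖ * ‖⟪e k, a⟫_ℂ‖) ∧
      ∑' k, ‖⟪b, e k⟫_ℂ‖ * ‖⟪e k, a⟫_ℂ‖ ≤ ‖b‖ * ‖a‖ := by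
  have hs : ∀ x : E, Summable fun k => ‖⟪e k, x⟫_ℂ‖ ^ (2 : ℝ) := fun x => by
    simpa using he.inner_products_summable x
  have ht : ∀ x : E, (∑' k, ‖⟪e k, x⟫_ℂ‖ ^ (2 : ℝ)) ^ (1 / 2 : ℝ) ≤ ‖x‖ := fun x => by
    have := he.tsum_inner_products_le x
    rw [← Real.sqrt_eq_rpow]
    refine Real.sqrt_le_iff.2 ⟨norm_nonneg _, by simpa using this⟩
  have := Real.summable_and_inner_le_Lp_mul_Lq_tsum_of_nonneg
    (Real.HolderConjugate.two_two) (f := fun k => ‖⟪e k, b⟫_ℂ‖) (g := fun k => ‖⟪e k, a⟫_ℂ‖)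
    (fun k => norm_nonneg _) (fun k => norm_nonneg _) (hs b) (hs a)
  simp only [norm_inner_symm b]
  refine ⟨this.1, this.2.trans ?_⟩
  gcongr
  · exact ht b
  · exact ht a

theorem IsNuclearRep.summable_inner {ι : Type} {A : E →L[ℂ] E} {a b : ι → E}
    (h : IsNuclearRep A a b) : Summable fun i => ⟪b i, a i⟫_ℂ :=
  Summable.of_norm_bounded h.summable fun i => by
    rw [mul_comm]; exact norm_inner_le_norm _ _

variable [CompleteSpace E]

theorem IsNuclearRep.mul_right {ι : Type} {A : E →L[ℂ] E} {a b : ι → E} (h : IsNuclearRep A a b)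
    (T : E →L[ℂ] E) : IsNuclearRep (A * T) a (fun i => star T (b i)) where
  summable := by
    refine Summable.of_nonneg_of_le (fun i => by positivity) (fun i => ?_)
      (h.summable.mul_left ‖star T‖)
    calc ‖a i‖ * ‖star T (b i)‖ ≤ ‖a i‖ * (‖star T‖ * ‖b i‖) := by
          gcongr; exact (star T).le_opNorm _
      _ = _ := by ring
  hasSum x := by
    simpa [ContinuousLinearMap.star_eq_adjoint, ContinuousLinearMap.adjoint_inner_left]
      using h.hasSum (T x)

theorem NuclearBound.mul_right {A : E →L[ℂ] E} {C : ℝ} (hA : NuclearBound A C) (T : E →L[ℂ] E) :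
    NuclearBound (A * T) (C * ‖T‖) := by
  obtain ⟨ι, a, b, h, h'⟩ := hA
  refine ⟨ι, _, _, h.mul_right T, ?_⟩
  calc ∑' i, ‖a i‖ * ‖star T (b i)‖ ≤ ∑' i, (‖a i‖ * ‖b i‖) * ‖T‖ := by
        refine (h.mul_right T).summable.tsum_le_tsum (fun i => ?_) (h.summable.mul_right _)
        rw [mul_assoc, mul_comm ‖b i‖, ← norm_star T]
        gcongr
        exact (star T).le_opNorm _
    _ ≤ C * ‖T‖ := by rw [tsum_mul_right]; gcongr

theorem IsNuclear.mul_right {A : E →L[ℂ] E} (hA : IsNuclear A) (T : E →L[ℂ] E) :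
    IsNuclear (A * T) := ⟨_, hA.choose_spec.mul_right T⟩

-- The double family ⟨bᵢ,eₖ⟩⟨eₖ,aᵢ⟩ is absolutely summable; summing over i first gives the diagonal
-- of A, summing over k first gives ⟨bᵢ,aᵢ⟩ by Parseval. Hence the trace depends neither on the
-- basis nor on the representation.
omit [CompleteSpace E] in
theorem IsNuclearRep.summable_and_hasSum {ι κ : Type} {A : E →L[ℂ] E} {a b : ι → E}
    (h : IsNuclearRep A a b) (e : HilbertBasis κ ℂ E) :
    Summable (fun k => ‖⟪e k, A (e k)⟫_ℂ‖) ∧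
      HasSum (fun k => ⟪e k, A (e k)⟫_ℂ) (∑' i, ⟪b i, a i⟫_ℂ) := by
  have hb := fun i => summable_norm_inner_mul_inner_le e.orthonormal (a i) (b i)
  have hF : Summable fun q : ι × κ => ‖⟪b q.1, e q.2⟫_ℂ * ⟪e q.2, a q.1⟫_ℂ‖ := by
    refine (summable_prod_of_nonneg fun q => norm_nonneg _).2 ⟨fun i => ?_, ?_⟩
    · simpa using (hb i).1
    · refine Summable.of_nonneg_of_le (fun i => tsum_nonneg fun k => norm_nonneg _) (fun i => ?_)
        h.summable
      rw [mul_comm]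
      simpa using (hb i).2
  have hk : ∀ k, HasSum (fun i => ⟪b i, e k⟫_ℂ * ⟪e k, a i⟫_ℂ) ⟪e k, A (e k)⟫_ℂ := fun k => by
    simpa [inner_smul_right] using (innerSL ℂ (e k)).hasSum (h.hasSum (e k))
  have hF' := hF.prod_symm
  constructor
  · refine Summable.of_nonneg_of_le (fun k => norm_nonneg _) (fun k => ?_) hF'.prod
    rw [← (hk k).tsum_eq]
    exact norm_tsum_le_tsum_norm (hF'.prod_factor k)
  · have h1 := hF'.of_norm.hasSum.prod_fiberwise hk
    have h2 := hF.of_norm.hasSum.prod_fiberwise fun i => e.hasSum_inner_mul_inner (b i) (a i)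
    have h3 : (∑' q : κ × ι, ⟪b q.swap.1, e q.swap.2⟫_ℂ * ⟪e q.swap.2, a q.swap.1⟫_ℂ) =
        ∑' q : ι × κ, ⟪b q.1, e q.2⟫_ℂ * ⟪e q.2, a q.1⟫_ℂ :=
      (Equiv.prodComm κ ι).tsum_eq (fun q : ι × κ => ⟪b q.1, e q.2⟫_ℂ * ⟪e q.2, a q.1⟫_ℂ)
    rw [h2.tsum_eq, ← h3]
    exact h1

theorem IsNuclearRep.trace_eq {ι : Type} {A : E →L[ℂ] E} {a b : ι → E}
    (h : IsNuclearRep A a b) : trace A = ∑' i, ⟪b i, a i⟫_ℂ :=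
  (h.summable_and_hasSum _).2.tsum_eq

omit [CompleteSpace E] in
theorem IsNuclear.summable_inner {κ : Type} {A : E →L[ℂ] E} (hA : IsNuclear A)
    (e : HilbertBasis κ ℂ E) : Summable (fun k => ‖⟪e k, A (e k)⟫_ℂ‖) := by
  obtain ⟨C, ι, a, b, h, -⟩ := hA
  exact (h.summable_and_hasSum e).1

theorem trace_add {A B : E →L[ℂ] E} (hA : IsNuclear A) (hB : IsNuclear B) :
    trace (A + B) = trace A + trace B := by
  simp only [trace, add_apply, inner_add_right]
  exact (hA.summable_inner _).of_norm.tsum_add (hB.summable_inner _).of_norm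

theorem trace_smul (z : ℂ) (A : E →L[ℂ] E) : trace (z • A) = z * trace A := by
  simp [trace, tsum_mul_left]

theorem trace_neg (A : E →L[ℂ] E) : trace (-A) = -trace A := by
  simp [trace, tsum_neg]

theorem trace_zero : trace (0 : E →L[ℂ] E) = 0 := by simp [trace]

theorem trace_sub {A B : E →L[ℂ] E} (hA : IsNuclear A) (hB : IsNuclear B) :
    trace (A - B) = trace A - trace B := by
  rw [sub_eq_add_neg, trace_add hA hB.neg, trace_neg, sub_eq_add_neg]

theorem trace_mul_comm {A : E →L[ℂ] E} (hA : IsNuclear A) (T : E →L[ℂ] E) :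
    trace (A * T) = trace (T * A) := by
  obtain ⟨C, ι, a, b, h, -⟩ := hA
  rw [(h.mul_left T).trace_eq, (h.mul_right T).trace_eq]
  simp [ContinuousLinearMap.star_eq_adjoint, ContinuousLinearMap.adjoint_inner_left]

/-- A series of nuclear operators with summable nuclear norms converging strongly to `Z` may be
traced termwise. -/
theorem isNuclear_and_hasSum_trace {Y : ℕ → E →L[ℂ] E} {Z : E →L[ℂ] E} {C : ℕ → ℝ}
    (h : ∀ n, NuclearBound (Y n) (C n)) (hs : Summable C) (hZ : HasSum Y Z) :
    IsNuclear Z ∧ HasSum (fun n => trace (Y n)) (trace Z) := by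
  choose ι a b hrep hC using h
  have hZx : ∀ x, HasSum (fun n => Y n x) (Z x) := fun x =>
    ((ContinuousLinearMap.apply ℂ E x : (E →L[ℂ] E) →L[ℂ] E)).hasSum hZ
  have hr := IsNuclearRep.sigma hrep hC hs hZx
  refine ⟨hr.isNuclear, ?_⟩
  have := hr.summable_inner.hasSum.sigma fun n => (hrep n).summable_inner.hasSum
  rw [hr.trace_eq]
  simpa only [(hrep _).trace_eq] using this

/-- Nuclear operators are trace class. -/
theorem IsNuclear.isTraceClass {A : E →L[ℂ] E} (hA : IsNuclear A) : IsTraceClass A := by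
  have hnorm : ∀ x, ‖CFC.abs A x‖ = ‖A x‖ := fun x => by
    have h1 : ⟪CFC.abs A x, CFC.abs A x⟫_ℂ = ⟪A x, A x⟫_ℂ := by
      have hsa : ContinuousLinearMap.adjoint (CFC.abs A) = CFC.abs A :=
        (CFC.abs_nonneg A).isSelfAdjoint
      rw [← ContinuousLinearMap.adjoint_inner_right, hsa,
        ← mul_apply_eq_comp, CFC.abs_mul_abs, mul_apply_eq_comp,
        ContinuousLinearMap.star_eq_adjoint, ContinuousLinearMap.adjoint_inner_right]
    rw [inner_self_eq_norm_sq_to_K, inner_self_eq_norm_sq_to_K] at h1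
    have h2 : ‖CFC.abs A x‖ ^ 2 = ‖A x‖ ^ 2 := by exact_mod_cast h1
    exact (sq_eq_sq₀ (norm_nonneg _) (norm_nonneg _)).1 h2
  set K := (LinearMap.range (A : E →ₗ[ℂ] E)).topologicalClosure with hK
  have : CompleteSpace K := (Submodule.isClosed_topologicalClosure _).completeSpace_coe
  let j : E →ₗ[ℂ] K := LinearMap.codRestrict K (A : E →ₗ[ℂ] E)
    fun x => Submodule.le_topologicalClosure _ ⟨x, rfl⟩
  have hj : DenseRange j := by
    rw [DenseRange, Subtype.dense_iff]
    intro y hy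
    have hy' : y ∈ closure (Set.range A) := by
      have := SetLike.mem_coe.1 hy
      rwa [hK, ← SetLike.mem_coe, Submodule.topologicalClosure_coe, LinearMap.coe_range] at this
    convert hy' using 2
    ext w
    simp [j, ← Set.range_comp]
  -- Polar decomposition read backwards: since |A|x and Ax have the same norm, Ax ↦ |A|x extends
  -- boundedly to the closed range, so |A| is a bounded operator times A and inherits nuclearity.
  let W : K →L[ℂ] E := LinearMap.extendOfNorm (CFC.abs A : E →L[ℂ] E).toLinearMap j
  have hW : ∀ x, W (j x) = CFC.abs A x := fun x =>
    LinearMap.extendOfNorm_eq hj ⟨1, fun x => by rw [one_mul]; exact (hnorm x).le⟩ x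
  have habs : CFC.abs A = (W ∘L K.orthogonalProjectionOnto) * A := by
    ext x
    have : K.orthogonalProjectionOnto (A x) = j x := by
      exact Submodule.orthogonalProjectionOnto_mem_subspace_eq_self (j x)
    simp [this, hW]
  intro κ e
  rw [habs]
  exact (hA.mul_left _).summable_inner e

end Nuclear

/-! ### Fredholm operators and Fedosov's index formula -/

section Fedosov

variable {E : Type} [NormedAddCommGroup E] [InnerProductSpace ℂ E] [CompleteSpace E]

/-- A nuclear operator is a finite rank operator up to an operator of small norm. -/
theorem IsNuclear.exists_finiteRange_add {A : E →L[ℂ] E} (hA : IsNuclear A) :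
    ∃ F R : E →L[ℂ] E, A = F + R ∧ (F : E →ₗ[ℂ] E).HasFiniteRange ∧ ‖R‖ < 1 := by
  obtain ⟨C, ι, a, b, h, -⟩ := hA
  obtain ⟨s, hs⟩ : ∃ s : Finset ι, ∑' i, ‖a i‖ * ‖b i‖ - 1 / 2 < ∑ i ∈ s, ‖a i‖ * ‖b i‖ :=
    (h.summable.hasSum.eventually (lt_mem_nhds (by linarith))).exists
  let F : E →L[ℂ] E := ∑ i ∈ s, InnerProductSpace.rankOne ℂ (a i) (b i)
  have hF : ∀ x, F x = ∑ i ∈ s, ⟪b i, x⟫_ℂ • a i := fun x => by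
    simp [F]
  refine ⟨F, A - F, by abel, ?_, ?_⟩
  · refine Submodule.FG.of_le (T := Submodule.span ℂ (a '' s))
      (Submodule.fg_span (s.finite_toSet.image a)) ?_
    rintro _ ⟨x, rfl⟩
    change F x ∈ _
    rw [hF]
    exact Submodule.sum_mem _ fun i hi => Submodule.smul_mem _ _
      (Submodule.subset_span ⟨i, hi, rfl⟩)
  · refine lt_of_le_of_lt (ContinuousLinearMap.opNorm_le_bound _ (by norm_num : (0 : ℝ) ≤ 1 / 2)
      fun x => ?_) (by norm_num)
    have hcompl := h.summable.sum_add_tsum_subtype_compl s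
    have hx := (h.hasSum x).summable.sum_add_tsum_subtype_compl s
    rw [(h.hasSum x).tsum_eq] at hx
    have hR : (A - F) x = ∑' i : { i // i ∉ s }, ⟪b i, x⟫_ℂ • a i := by
      rw [sub_apply, hF, ← hx]; abel
    rw [hR]
    have hsx : Summable fun i : { i // i ∉ s } => (‖a i‖ * ‖b i‖) * ‖x‖ :=
      (h.summable.subtype _).mul_right _
    refine (tsum_of_norm_bounded hsx.hasSum fun i => ?_).trans ?_
    · rw [norm_smul]
      calc ‖⟪b i, x⟫_ℂ‖ * ‖a i‖ ≤ (‖b i‖ * ‖x‖) * ‖a i‖ := by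
            gcongr; exact norm_inner_le_norm _ _
        _ = _ := by ring
    · rw [tsum_mul_right]
      gcongr
      linarith

-- With N = F + R, F of finite rank and ‖R‖ < 1, the Neumann inverse of 1 - R inverts 1 - N modulo
-- finite rank.
open LinearMap.FiniteRangeSetoid in
theorem IsNuclear.exists_mul_one_sub_equiv {N : E →L[ℂ] E} (hN : IsNuclear N) :
    ∃ W : E →L[ℂ] E, ((W * (1 - N) : E →L[ℂ] E) : E →ₗ[ℂ] E) ≈ LinearMap.id ∧
      (((1 - N) * W : E →L[ℂ] E) : E →ₗ[ℂ] E) ≈ LinearMap.id := by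
  obtain ⟨F, R, rfl, hF, hR⟩ := hN.exists_finiteRange_add
  obtain ⟨w, hw⟩ := isUnit_one_sub_of_norm_lt_one hR
  have h1 : (↑w⁻¹ : E →L[ℂ] E) * (1 - R) = 1 := by rw [← hw]; simp
  have h2 : (1 - R) * (↑w⁻¹ : E →L[ℂ] E) = 1 := by rw [← hw]; simp
  refine ⟨(↑w⁻¹ : E →L[ℂ] E), ?_, ?_⟩
  · rw [equiv_iff_hasFiniteRange]
    have : (((↑w⁻¹ : E →L[ℂ] E) * (1 - (F + R)) : E →L[ℂ] E) : E →ₗ[ℂ] E) - LinearMap.id =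
        -(((↑w⁻¹ : E →L[ℂ] E) : E →ₗ[ℂ] E) ∘ₗ (F : E →ₗ[ℂ] E)) := by
      have : (↑w⁻¹ : E →L[ℂ] E) * (1 - (F + R)) = 1 - ↑w⁻¹ * F := by
        
        rw [add_comm F R, ← sub_sub, mul_sub, h1]
      rw [this]
      ext x; simp
    rw [this]
    exact (hF.comp_left _).neg
  · rw [equiv_iff_hasFiniteRange]
    have : (((1 - (F + R)) * (↑w⁻¹ : E →L[ℂ] E) : E →L[ℂ] E) : E →ₗ[ℂ] E) - LinearMap.id =
        -((F : E →ₗ[ℂ] E) ∘ₗ ((↑w⁻¹ : E →L[ℂ] E) : E →ₗ[ℂ] E)) := by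
      have : (1 - (F + R)) * (↑w⁻¹ : E →L[ℂ] E) = 1 - F * ↑w⁻¹ := by
        
        rw [add_comm F R, ← sub_sub, sub_mul, h2]
      rw [this]
      ext x; simp
    rw [this]
    exact (hF.comp_right _).neg

open LinearMap.FiniteRangeSetoid in
/-- An operator that is invertible modulo nuclear operators is Fredholm. -/
theorem isFredholm_of_isNuclear {S T : E →L[ℂ] E} (h1 : IsNuclear (1 - S * T))
    (h2 : IsNuclear (1 - T * S)) : T.IsFredholm := by
  obtain ⟨W1, hW1, -⟩ := h1.exists_mul_one_sub_equiv
  obtain ⟨W2, -, hW2⟩ := h2.exists_mul_one_sub_equiv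
  rw [sub_sub_cancel] at hW1 hW2
  have hl : (W1 * S : E →L[ℂ] E).toLinearMap ∘ₗ T.toLinearMap ≈ LinearMap.id := hW1
  have hr : T.toLinearMap ∘ₗ (S * W2 : E →L[ℂ] E).toLinearMap ≈ LinearMap.id := hW2
  refine ContinuousLinearMap.IsFredholm.of_isQuasiInverse (v := W1 * S) ⟨hl, ?_⟩
  -- As in a monoid, a left inverse and a right inverse modulo finite rank must agree modulo finite
  -- rank.
  have : (W1 * S : E →L[ℂ] E).toLinearMap ≈ (S * W2 : E →L[ℂ] E).toLinearMap := by
    calc (W1 * S : E →L[ℂ] E).toLinearMap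
        = (W1 * S : E →L[ℂ] E).toLinearMap ∘ₗ LinearMap.id := by simp
      _ ≈ (W1 * S : E →L[ℂ] E).toLinearMap ∘ₗ
            (T.toLinearMap ∘ₗ (S * W2 : E →L[ℂ] E).toLinearMap) :=
          equiv_comp_left (Setoid.symm hr)
      _ = ((W1 * S : E →L[ℂ] E).toLinearMap ∘ₗ T.toLinearMap) ∘ₗ
            (S * W2 : E →L[ℂ] E).toLinearMap := rfl
      _ ≈ LinearMap.id ∘ₗ (S * W2 : E →L[ℂ] E).toLinearMap := equiv_comp_right hl
      _ = (S * W2 : E →L[ℂ] E).toLinearMap := by simp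
  exact Setoid.trans (equiv_comp_left this) hr

/-- The trace of a bounded projection on a finite dimensional subspace is its rank. -/
theorem isNuclear_and_trace_of_projection {Q : E →L[ℂ] E} {K : Submodule ℂ E}
    [FiniteDimensional ℂ K] (hK : ∀ x, Q x ∈ K) (hQ : ∀ x ∈ K, Q x = x) :
    IsNuclear Q ∧ trace Q = Module.finrank ℂ K := by
  let e := stdOrthonormalBasis ℂ K
  have hrep : IsNuclearRep Q (fun j => (e j : E)) (fun j => star Q (e j : E)) := by
    refine ⟨Summable.of_finite, fun x => ?_⟩
    have h := congrArg Subtype.val (e.sum_repr' ⟨Q x, hK x⟩)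
    have h' : ∑ j, ⟪star Q (e j : E), x⟫_ℂ • (e j : E) = Q x := by
      simpa [ContinuousLinearMap.star_eq_adjoint, ContinuousLinearMap.adjoint_inner_left] using h
    rw [← h']
    exact hasSum_fintype _
  refine ⟨hrep.isNuclear, ?_⟩
  have hone : ∀ j, ⟪(e j : E), (e j : E)⟫_ℂ = 1 := fun j => by
    have := e.orthonormal.1 j
    rw [inner_self_eq_norm_sq_to_K]
    have h' : ‖(e j : E)‖ = 1 := this
    simp [h']
  rw [hrep.trace_eq]
  simp only [ContinuousLinearMap.star_eq_adjoint, ContinuousLinearMap.adjoint_inner_left]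
  simp only [hQ _ (Submodule.coe_mem _), hone]
  simp

/-- Fedosov's formula for the index of an operator that is invertible modulo nuclear operators. -/
theorem index_eq_trace_sub_trace {S T : E →L[ℂ] E} (h1 : IsNuclear (1 - S * T))
    (h2 : IsNuclear (1 - T * S)) :
    ((T : E →ₗ[ℂ] E).index : ℂ) = trace (1 - S * T) - trace (1 - T * S) := by
  obtain ⟨pkg⟩ := (isFredholm_of_isNuclear h1 h2).nonempty_fredholmPackage
  set v := pkg.quasiInverse with hv
  have hvT : ∀ x, v (T x) = pkg.decDom.proj x := fun x => by
    have h := congrArg (fun f => f x) pkg.eq_equiv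
    rw [h, hv, ContinuousLinearMap.FredholmPackage.quasiInverse]
    simp
  have hTv : ∀ x, T (v x) = pkg.decCodom.proj x := fun x => by
    have h := congrArg (fun f => f (v x)) pkg.eq_equiv
    rw [h, hv, ContinuousLinearMap.FredholmPackage.quasiInverse]
    simp
  have := pkg.decDom.finite_X₀
  have := pkg.decCodom.finite_X₀
  have hproj : ∀ (dec : FredholmDecomposition ℂ E) (Q : E →L[ℂ] E),
      (∀ x, Q x = x - dec.proj x) → (∀ x, Q x ∈ dec.X₀) ∧ ∀ x ∈ dec.X₀, Q x = x := by
    intro dec Q hQ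
    refine ⟨fun x => ?_, fun x hx => ?_⟩
    · rw [← Submodule.projectionOntoL_apply_eq_zero_iff dec.isTopCompl, hQ, map_sub,
        Submodule.projectionOntoL_apply_left, sub_self]
    · rw [hQ, (Submodule.projectionOntoL_apply_eq_zero_iff dec.isTopCompl).2 hx]
      simp
  obtain ⟨hk1, hk2⟩ := hproj pkg.decDom (1 - v * T) fun x => by simp [hvT]
  obtain ⟨hc1, hc2⟩ := hproj pkg.decCodom (1 - T * v) fun x => by simp [hTv]
  obtain ⟨hn1, ht1⟩ := isNuclear_and_trace_of_projection hk1 hk2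
  obtain ⟨hn2, ht2⟩ := isNuclear_and_trace_of_projection hc1 hc2
  -- For the quasi-inverse v the two defects are finite rank projections whose traces are the
  -- dimensions of kernel and cokernel. Replacing v by S changes the two traces by Tr((S-v)T) and
  -- Tr(T(S-v)), which cancel once S - v is nuclear.
  have hTR : IsNuclear (T * (S - v)) := by
    have : T * (S - v) = (1 - T * v) - (1 - T * S) := by noncomm_ring
    rw [this]; exact hn2.sub h2
  have hR : IsNuclear (S - v) := by
    have : S - v = v * (T * (S - v)) + (1 - v * T) * (S - v) := by noncomm_ring
    rw [this]; exact (hTR.mul_left v).add (hn1.mul_right _)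
  have e1 : 1 - S * T = (1 - v * T) - (S - v) * T := by noncomm_ring
  have e2 : 1 - T * S = (1 - T * v) - T * (S - v) := by noncomm_ring
  rw [e1, e2, trace_sub hn1 (hR.mul_right T), trace_sub hn2 hTR, trace_mul_comm hR, ht1, ht2,
    LinearMap.index_eq_finrank_sub]
  have hker : Module.finrank ℂ (T : E →ₗ[ℂ] E).ker = Module.finrank ℂ pkg.decDom.X₀ := by
    rw [← pkg.ker_eq]
  have hcok : Module.finrank ℂ (E ⧸ (T : E →ₗ[ℂ] E).range) =
      Module.finrank ℂ pkg.decCodom.X₀ := by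
    have := pkg.range_eq
    rw [this]
    exact (Submodule.quotientEquivOfIsCompl _ _ pkg.decCodom.isTopCompl.isCompl).finrank_eq
  rw [hker, hcok]
  push_cast
  ring

end Fedosov

/-! ### Powers and exponentials of an operator that is almost a projection -/

section Powers

variable {E : Type} [NormedAddCommGroup E] [InnerProductSpace ℂ E] [CompleteSpace E]

omit [CompleteSpace E] in
theorem NuclearBound.mul_left_contraction {X A : E →L[ℂ] E} {C : ℝ} (h : NuclearBound X C)
    (hA : ‖A‖ ≤ 1) : NuclearBound (A * X) C :=
  (h.mul_left A).mono (mul_le_of_le_one_left h.nonneg hA)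

theorem NuclearBound.mul_right_contraction {X A : E →L[ℂ] E} {C : ℝ} (h : NuclearBound X C)
    (hA : ‖A‖ ≤ 1) : NuclearBound (X * A) C :=
  (h.mul_right A).mono (mul_le_of_le_one_right h.nonneg hA)

omit [CompleteSpace E] in
theorem norm_pow_le_one {A : E →L[ℂ] E} (hA : ‖A‖ ≤ 1) (n : ℕ) : ‖A ^ n‖ ≤ 1 := by
  rcases n.eq_zero_or_pos with rfl | hn
  · rw [pow_zero]
    exact ContinuousLinearMap.norm_id_le
  · exact (norm_pow_le' A hn).trans (pow_le_one₀ (norm_nonneg _) hA)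

/-- A^{n+1} - A telescopes into n terms, each a power of A times A² - A, and powers of A are
contractions. -/
theorem NuclearBound.mul_pow_sub {A X : E →L[ℂ] E} {κ : ℝ} (hA : ‖A‖ ≤ 1)
    (h : NuclearBound (X * (A - A ^ 2)) κ) (n : ℕ) :
    NuclearBound (X * (A ^ (n + 1) - A)) (n * κ) := by
  induction n with
  | zero => simpa using NuclearBound.zero
  | succ n ih =>
    have : X * (A ^ (n + 1 + 1) - A) = X * (A ^ (n + 1) - A) * A - X * (A - A ^ 2) := by
      rw [pow_succ A (n + 1)]; noncomm_ring
    rw [this]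
    refine ((ih.mul_right_contraction hA).sub h).mono ?_
    push_cast; linarith

/-- [A,L] itself is not assumed nuclear. The recursion only uses it multiplied by A^{n+1} - A, which
costs nκ, and [A - A²,L], which costs κ; as n² + n + 1 ≤ (n+1)², the growth is quadratic. -/
theorem NuclearBound.commutator_pow_sub {A L : E →L[ℂ] E} {κ : ℝ} (hA : ‖A‖ ≤ 1)
    (h : NuclearBound ((A * L - L * A) * (A - A ^ 2)) κ)
    (h' : NuclearBound ((A - A ^ 2) * L - L * (A - A ^ 2)) κ) (n : ℕ) :
    NuclearBound ((A ^ (n + 1) - A) * L - L * (A ^ (n + 1) - A)) (n ^ 2 * κ) := by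
  induction n with
  | zero => simpa using NuclearBound.zero
  | succ n ih =>
    have : (A ^ (n + 1 + 1) - A) * L - L * (A ^ (n + 1 + 1) - A) =
        A * ((A ^ (n + 1) - A) * L - L * (A ^ (n + 1) - A)) +
          (A * L - L * A) * (A ^ (n + 1) - A) - ((A - A ^ 2) * L - L * (A - A ^ 2)) := by
      rw [pow_succ' A (n + 1)]; noncomm_ring
    rw [this]
    refine (((ih.mul_left_contraction hA).add (h.mul_pow_sub hA n)).sub h').mono ?_
    have := h.nonneg
    push_cast
    nlinarith [mul_nonneg (Nat.cast_nonneg (α := ℝ) n) this]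

theorem NuclearBound.commutator_pow_mul {A L G : E →L[ℂ] E} {κ : ℝ} (hA : ‖A‖ ≤ 1)
    (hG : A * G = G * A) (h : NuclearBound ((A * L - L * A) * G) κ) (n : ℕ) :
    NuclearBound ((A ^ n * L - L * A ^ n) * G) (n * κ) := by
  have hG' : Commute A G := hG
  induction n with
  | zero => simpa using NuclearBound.zero
  | succ n ih =>
    have : (A ^ (n + 1) * L - L * A ^ (n + 1)) * G =
        A * ((A ^ n * L - L * A ^ n) * G) + (A * L - L * A) * G * A ^ n := by
      rw [mul_assoc _ G, ← (hG'.pow_left n).eq, pow_succ' A n]; noncomm_ring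
    have hn := norm_pow_le_one hA n
    rw [this]
    refine ((ih.mul_left_contraction hA).add (h.mul_right_contraction hn)).mono ?_
    push_cast; linarith

/-- Leibniz rule for [A^{n+1},L]: since G commutes with A, cyclicity gives all n + 1 terms the same
trace. -/
theorem trace_pow_mul_commutator_pow_mul {A L G : E →L[ℂ] E} (hA : ‖A‖ ≤ 1)
    (hG : A * G = G * A) (h : IsNuclear ((A * L - L * A) * G)) (n m : ℕ) :
    trace (A ^ m * ((A ^ (n + 1) * L - L * A ^ (n + 1)) * G)) =
      (n + 1) * trace ((A * L - L * A) * G * A ^ (m + n)) := by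
  have hG' : Commute A G := hG
  induction n generalizing m with
  | zero => simpa using (trace_mul_comm h (A ^ m)).symm
  | succ n ih =>
    obtain ⟨κ, hκ⟩ := h
    have : A ^ m * ((A ^ (n + 1 + 1) * L - L * A ^ (n + 1 + 1)) * G) =
        A ^ (m + 1) * ((A ^ (n + 1) * L - L * A ^ (n + 1)) * G) +
          A ^ m * ((A * L - L * A) * G * A ^ (n + 1)) := by
      rw [mul_assoc _ G, ← (hG'.pow_left (n + 1)).eq, pow_succ' A (n + 1), pow_succ A m]
      noncomm_ring
    rw [this, trace_add ((hκ.commutator_pow_mul hA hG _).isNuclear.mul_left _)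
      ((hκ.isNuclear.mul_right _).mul_left _), ih, ← trace_mul_comm (hκ.isNuclear.mul_right _),
      mul_assoc _ (A ^ (n + 1)), ← pow_add]
    have e1 : m + 1 + n = m + (n + 1) := by ring
    have e2 : n + 1 + m = m + (n + 1) := by ring
    rw [e1, e2]
    push_cast
    ring

/-- The trace of a nuclear commutator with a projection vanishes. -/
theorem trace_commutator_idempotent {Y L : E →L[ℂ] E} (hL : L * L = L)
    (h : IsNuclear (Y * L - L * Y)) : trace (Y * L - L * Y) = 0 := by
  set Z := Y * L - L * Y with hZ
  -- Both diagonal blocks of a commutator with L vanish, and off-diagonal blocks carry no trace.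
  have h1 : L * Z * L = 0 := by
    have : L * Z * L = L * Y * (L * L) - (L * L) * Y * L := by rw [hZ]; noncomm_ring
    rw [this, hL, sub_self]
  have h2 : (1 - L) * Z * (1 - L) = 0 := by
    have : (1 - L) * Z * (1 - L) = (L * L - L) * Y + Y * (L - L * L) +
      L * Y * (L * L - L) - (L * L - L) * Y * L := by rw [hZ]; noncomm_ring
    rw [this, hL]; simp
  have hL' : (1 - L) * (1 - L) = 1 - L := by
    have : (1 - L) * (1 - L) = 1 - L - (L - L * L) := by noncomm_ring
    rw [this, hL]; simp
  have key : ∀ R : E →L[ℂ] E, R * R = R → R * Z * R = 0 → trace (R * Z) = 0 := by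
    intro R hR hRZ
    rw [← hR, mul_assoc, ← trace_mul_comm (h.mul_left R), hRZ, trace_zero]
  have : Z = L * Z + (1 - L) * Z := by noncomm_ring
  rw [this, trace_add (h.mul_left _) (h.mul_left _), key L hL h1, key _ hL' h2, add_zero]

end Powers

/-! ### Exponential series and termwise traces. -/

section Exponential

variable {E : Type} [NormedAddCommGroup E] [InnerProductSpace ℂ E] [CompleteSpace E]

theorem hasSum_of_forall_eq {f g : ℕ → ℂ} {a : ℂ} (hf : HasSum f a) (h : ∀ n, f n = g n) :
    HasSum g a := (funext h : f = g) ▸ hf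

/-- The coefficients of `exp (z x) - 1`, without the constant one. -/
def expCoeff (z : ℂ) (n : ℕ) : ℂ := z ^ (n + 1) / (n + 1).factorial

theorem expCoeff_mul_succ (z : ℂ) (n : ℕ) :
    expCoeff z n * (n + 1) = z * (z ^ n / n.factorial) := by
  rw [expCoeff, Nat.factorial_succ, pow_succ]
  have : (n.factorial : ℂ) ≠ 0 := by exact_mod_cast n.factorial_ne_zero
  have : (n + 1 : ℂ) ≠ 0 := by exact_mod_cast n.succ_ne_zero
  push_cast
  field_simp

theorem hasSum_exp_series (z : ℂ) : HasSum (fun n : ℕ => z ^ n / n.factorial) (Complex.exp z) := by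
  rw [Complex.exp_eq_exp_ℂ]
  exact NormedSpace.expSeries_div_hasSum_exp z

theorem hasSum_expCoeff (z : ℂ) : HasSum (expCoeff z) (Complex.exp z - 1) := by
  have := (hasSum_nat_add_iff' (f := fun n : ℕ => z ^ n / (n.factorial : ℂ)) 1).2
    (hasSum_exp_series z)
  have e : expCoeff z = fun n => z ^ (n + 1) / ((n + 1).factorial : ℂ) := rfl
  rw [e]
  simpa using this

/-- The factor 1/(n+2) turns (n+1)! into (n+2)!, leaving the exponential series without its first
two terms, divided by z. At e^z = 1 the sum is -1, the source of the nonzero index. -/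
theorem hasSum_expCoeff_div {z : ℂ} (hz : z ≠ 0) :
    HasSum (fun n : ℕ => expCoeff z n * (1 / (n + 2))) ((Complex.exp z - 1 - z) / z) := by
  have := (hasSum_nat_add_iff' (f := fun n : ℕ => z ^ n / (n.factorial : ℂ)) 2).2
    (hasSum_exp_series z)
  have h := this.div_const z
  have e : (Complex.exp z - ∑ i ∈ Finset.range 2, z ^ i / (i.factorial : ℂ)) / z =
      (Complex.exp z - 1 - z) / z := by
    simp [Finset.sum_range_succ, ← sub_sub]
  rw [e] at h
  refine hasSum_of_forall_eq h fun n => ?_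
  rw [expCoeff, Nat.factorial_succ (n + 1), pow_succ z (n + 1)]
  have h1 : ((n + 1).factorial : ℂ) ≠ 0 := by exact_mod_cast (n + 1).factorial_ne_zero
  have h2 : (n + 2 : ℂ) ≠ 0 := by exact_mod_cast (n + 1).succ_ne_zero
  have h3 : (n + 1 + 1 : ℂ) = n + 2 := by ring
  push_cast
  rw [h3]
  field_simp

theorem summable_norm_expCoeff_mul_sq (z : ℂ) :
    Summable fun n : ℕ => ‖expCoeff z n‖ * (n + 1) ^ 2 := by
  have h := Real.summable_pow_div_factorial ‖z‖
  have h1 : Summable fun n : ℕ => n * (‖z‖ ^ n / n.factorial) := by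
    rw [← summable_nat_add_iff 1]
    refine (h.mul_left ‖z‖).congr fun n => ?_
    have h1 : (n.factorial : ℝ) ≠ 0 := by exact_mod_cast n.factorial_ne_zero
    rw [Nat.factorial_succ, pow_succ]
    push_cast
    field_simp
  refine ((h1.add h).mul_left ‖z‖).congr fun n => ?_
  have h2 : ‖expCoeff z n‖ * (n + 1) = ‖z‖ * (‖z‖ ^ n / n.factorial) := by
    have := congrArg norm (expCoeff_mul_succ z n)
    simp only [norm_mul, norm_div, norm_pow, Complex.norm_natCast] at this
    rw [← this]
    congr 1
    norm_cast
  rw [pow_two, ← mul_assoc, h2]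
  ring

theorem hasSum_exp_operator (z : ℂ) (A : E →L[ℂ] E) :
    HasSum (fun n : ℕ => (z ^ n / n.factorial) • A ^ n) (NormedSpace.exp (z • A)) := by
  have := NormedSpace.exp_series_hasSum_exp' (𝕂 := ℂ) (z • A)
  simpa [smul_pow, smul_smul, div_eq_inv_mul] using this

theorem hasSum_exp_operator_sub_one (z : ℂ) (A : E →L[ℂ] E) :
    HasSum (fun n : ℕ => expCoeff z n • A ^ (n + 1)) (NormedSpace.exp (z • A) - 1) := by
  have := (hasSum_nat_add_iff' (f := fun n : ℕ => (z ^ n / (n.factorial : ℂ)) • A ^ n) 1).2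
    (hasSum_exp_operator z A)
  simpa [expCoeff] using this

/-- Subtracting (e^z - 1)A = 0 from the series makes every term a multiple of A - A². -/
theorem hasSum_exp_operator_sub_one' {z : ℂ} (hz : Complex.exp z = 1) (A : E →L[ℂ] E) :
    HasSum (fun n : ℕ => expCoeff z n • (A ^ (n + 1) - A)) (NormedSpace.exp (z • A) - 1) := by
  have := (hasSum_exp_operator_sub_one z A).sub ((hasSum_expCoeff z).smul_const A)
  simpa [hz, smul_sub] using this

variable {A L : E →L[ℂ] E} {z : ℂ}

theorem isNuclear_commutator_exp (hz : Complex.exp z = 1) (hA : ‖A‖ ≤ 1)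
    (h : IsNuclear ((A * L - L * A) * (A - A ^ 2)))
    (h' : IsNuclear ((A - A ^ 2) * L - L * (A - A ^ 2))) :
    IsNuclear (NormedSpace.exp (z • A) * L - L * NormedSpace.exp (z • A)) := by
  obtain ⟨κ, hκ⟩ := h
  obtain ⟨κ', hκ'⟩ := h'
  have hb := NuclearBound.commutator_pow_sub hA (hκ.mono (le_max_left κ κ'))
    (hκ'.mono (le_max_right κ κ'))
  have hs := hasSum_exp_operator_sub_one' hz A
  have hs' := (hs.mul_right L).sub (hs.mul_left L)
  have : NormedSpace.exp (z • A) * L - L * NormedSpace.exp (z • A) =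
      (NormedSpace.exp (z • A) - 1) * L - L * (NormedSpace.exp (z • A) - 1) := by noncomm_ring
  rw [this]
  refine (isNuclear_and_hasSum_trace (C := fun n => ‖expCoeff z n‖ * (n + 1) ^ 2 * max κ κ')
    (fun n => ?_) ((summable_norm_expCoeff_mul_sq z).mul_right _) hs').1
  rw [smul_mul_assoc, mul_smul_comm, ← smul_sub]
  refine ((hb n).smul _).mono ?_
  have := (hb 1).nonneg
  rw [mul_assoc]
  have : 0 ≤ max κ κ' := by simpa using this
  gcongr
  linarith

theorem hasSum_trace_mul_exp_sub_one (hz : Complex.exp z = 1) (hA : ‖A‖ ≤ 1) {X : E →L[ℂ] E}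
    (h : IsNuclear (X * (A - A ^ 2))) :
    IsNuclear (X * (NormedSpace.exp (z • A) - 1)) ∧
      HasSum (fun n => expCoeff z n * trace (X * (A ^ (n + 1) - A)))
        (trace (X * (NormedSpace.exp (z • A) - 1))) := by
  obtain ⟨κ, hκ⟩ := h
  have hs := (hasSum_exp_operator_sub_one' hz A).mul_left X
  have := isNuclear_and_hasSum_trace (C := fun n => ‖expCoeff z n‖ * (n + 1) ^ 2 * κ)
    (fun n => ?_) ((summable_norm_expCoeff_mul_sq z).mul_right _) hs
  · simpa only [mul_smul_comm, trace_smul] using this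
  · rw [mul_smul_comm]
    refine ((hκ.mul_pow_sub hA n).smul _).mono ?_
    have := hκ.nonneg
    rw [mul_assoc]
    gcongr
    nlinarith [Nat.cast_nonneg (α := ℝ) n]

/-- The derivation [·,L] acts on e^{zA} under the trace as on a scalar exponential: the n + 1 equal
Leibniz terms lower the factorial. The factor G supplies the nuclearity that [A,L] lacks. -/
theorem trace_commutator_exp_mul (hA : ‖A‖ ≤ 1) {G : E →L[ℂ] E} (hG : A * G = G * A)
    (h : IsNuclear ((A * L - L * A) * G)) :
    trace ((NormedSpace.exp (z • A) * L - L * NormedSpace.exp (z • A)) * G) =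
      z * trace ((A * L - L * A) * G * NormedSpace.exp (z • A)) := by
  obtain ⟨κ, hκ⟩ := h
  have hs := hasSum_exp_operator_sub_one z A
  have hs' := ((hs.mul_right L).sub (hs.mul_left L)).mul_right G
  have e : (NormedSpace.exp (z • A) * L - L * NormedSpace.exp (z • A)) * G =
    ((NormedSpace.exp (z • A) - 1) * L - L * (NormedSpace.exp (z • A) - 1)) * G := by noncomm_ring
  have h1 := (isNuclear_and_hasSum_trace (C := fun n => ‖expCoeff z n‖ * (n + 1) ^ 2 * κ)
    (fun n => ?_) ((summable_norm_expCoeff_mul_sq z).mul_right _) hs').2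
  · have h2 := (isNuclear_and_hasSum_trace
      (C := fun n => (‖z‖ ^ n / n.factorial) * κ) (fun n => ?_)
      ((Real.summable_pow_div_factorial ‖z‖).mul_right _)
      ((hasSum_exp_operator z A).mul_left ((A * L - L * A) * G))).2
    · rw [e]
      refine h1.unique (hasSum_of_forall_eq (h2.mul_left z) fun n => ?_)
      have := trace_pow_mul_commutator_pow_mul hA hG ⟨κ, hκ⟩ n 0
      rw [pow_zero, one_mul, zero_add] at this
      rw [mul_smul_comm, trace_smul, smul_mul_assoc, mul_smul_comm, ← smul_sub, smul_mul_assoc,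
        trace_smul, this, ← mul_assoc, ← mul_assoc, expCoeff_mul_succ]
    · have hn := norm_pow_le_one hA n
      rw [mul_smul_comm]
      exact ((hκ.mul_right_contraction hn).smul _).mono (by simp)
  · rw [smul_mul_assoc, mul_smul_comm, ← smul_sub, smul_mul_assoc]
    refine ((hκ.commutator_pow_mul hA hG (n + 1)).smul _).mono ?_
    have := hκ.nonneg
    rw [mul_assoc]
    gcongr
    push_cast
    nlinarith [Nat.cast_nonneg (α := ℝ) n]

end Exponential

/-! ### The index formula for commuting projections -/

section Algebra

/-- Idempotents `c`, `l`, `p` of a ring such that `c` and `l` commute. -/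
structure IdempotentTriple {R : Type} [Ring R] (c l p : R) : Prop where
  cc : c * c = c
  ll : l * l = l
  pp : p * p = p
  lc : l * c = c * l

namespace IdempotentTriple

set_option linter.unusedSimpArgs false

variable {R : Type} [Ring R] {c l p : R} (h : IdempotentTriple c l p)
include h

theorem cc_assoc (x : R) : c * (c * x) = c * x := by rw [← mul_assoc, h.cc]
theorem ll_assoc (x : R) : l * (l * x) = l * x := by rw [← mul_assoc, h.ll]
theorem pp_assoc (x : R) : p * (p * x) = p * x := by rw [← mul_assoc, h.pp]
theorem lc_assoc (x : R) : l * (c * x) = c * (l * x) := by rw [← mul_assoc, h.lc, mul_assoc]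

/-- This identity and the next four exhibit, in every term, an adjacent product of a commutator of c
with p and one of l with p, in one order or the other. Such products are what will be assumed
nuclear. -/
theorem commutator_cpc_mul :
    (c * p * c * l - l * (c * p * c)) * (c * p * c - (c * p * c) ^ 2) =
      c * ((l * p - p * l) * (c * p - p * c)) * ((1 - c) * (c * p - p * c) * c) := by
  simp only [pow_two, mul_sub, sub_mul, one_mul, mul_one, mul_assoc, h.cc, h.ll, h.pp, h.lc,
    h.cc_assoc, h.ll_assoc, h.pp_assoc, h.lc_assoc]
  abel

theorem commutator_cpc_sub_sq :
    (c * p * c - (c * p * c) ^ 2) * l - l * (c * p * c - (c * p * c) ^ 2) =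
      c * ((1 - c) * ((c * p - p * c) * (l * p - p * l)) -
        (c * p - p * c) * (l * p - p * l) * c + c * ((l * p - p * l) * (c * p - p * c)) -
        (l * p - p * l) * (c * p - p * c) * (1 - c)) := by
  simp only [pow_two, mul_sub, sub_mul, mul_add, add_mul, one_mul, mul_one, mul_assoc, h.cc, h.ll,
    h.pp, h.lc, h.cc_assoc, h.ll_assoc, h.pp_assoc, h.lc_assoc]
  abel

theorem commutator_pcp_mul :
    (p * c * p * l - l * (p * c * p)) * (p * c * p - (p * c * p) ^ 2) =
      p * c * ((l * p - p * l) * (c * p - p * c)) * ((1 - p) * (c * p - p * c) * p) +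
        (l * p - p * l) * (c * p - p * c) * ((1 - c) * (1 - p) * (c * p - p * c) * p) := by
  simp only [pow_two, mul_sub, sub_mul, mul_add, add_mul, one_mul, mul_one, mul_assoc, h.cc, h.ll,
    h.pp, h.lc, h.cc_assoc, h.ll_assoc, h.pp_assoc, h.lc_assoc]
  abel

theorem commutator_pcp_sub_sq :
    (p * c * p - (p * c * p) ^ 2) * l - l * (p * c * p - (p * c * p) ^ 2) =
      p * ((1 - c) * ((c * p - p * c) * (l * p - p * l)) -
        (c * p - p * c) * (l * p - p * l) * c + c * ((l * p - p * l) * (c * p - p * c)) -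
        (l * p - p * l) * (c * p - p * c) * (1 - c)) +
        (l * p - p * l) * (c * p - p * c) * (c * p - p * c) := by
  simp only [pow_two, mul_sub, sub_mul, mul_add, add_mul, one_mul, mul_one, mul_assoc, h.cc, h.ll,
    h.pp, h.lc, h.cc_assoc, h.ll_assoc, h.pp_assoc, h.lc_assoc]
  abel

theorem commutator_cpc_mul_sub :
    (c * p * c * l - l * (c * p * c)) * (c * p) * (p - p * c * p) =
      -(c * ((l * p - p * l) * (c * p - p * c)) * ((1 - c) * p)) := by
  simp only [mul_sub, sub_mul, one_mul, mul_one, mul_assoc, h.cc, h.ll, h.pp, h.lc, h.cc_assoc,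
    h.ll_assoc, h.pp_assoc, h.lc_assoc]
  abel

theorem commutator_compressions :
    p * c * p * (p * l * p) - p * l * p * (p * c * p) =
      p * ((c * p - p * c) * (l * p - p * l) - (l * p - p * l) * (c * p - p * c)) * p := by
  simp only [mul_sub, sub_mul, one_mul, mul_one, mul_assoc, h.cc, h.ll, h.pp, h.lc, h.cc_assoc,
    h.ll_assoc, h.pp_assoc, h.lc_assoc]
  abel

/-- With B = pcp, M = plp and J = p[c,p][l,p]p the right side is B[B,M] - [B,J]. This transfers the
computation from cpc to pcp, where the commutator with plp is itself nuclear. -/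
theorem conj_commutator_cpc :
    p * c * ((c * p * c * l - l * (c * p * c)) * (c * p)) =
      p * c * p * (p * c * p * (p * l * p) - p * l * p * (p * c * p)) -
        (p * c * p * (p * ((c * p - p * c) * (l * p - p * l)) * p) -
          p * ((c * p - p * c) * (l * p - p * l)) * p * (p * c * p)) := by
  simp only [mul_sub, sub_mul, one_mul, mul_one, mul_assoc, h.cc, h.ll, h.pp, h.lc, h.cc_assoc,
    h.ll_assoc, h.pp_assoc, h.lc_assoc]
  abel

theorem p_mul_pcp : p * (p * c * p) = p * c * p := by
  simp only [mul_assoc, h.pp_assoc]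

theorem pcp_mul_p : p * c * p * p = p * c * p := by
  simp only [mul_assoc, h.pp]

/-- The rule (xy)^{n+1} = x(yx)^n y with x = cp and y = pc. -/
theorem cpc_pow (n : ℕ) : (c * p * c) ^ (n + 1) = c * p * (p * c * p) ^ n * (p * c) := by
  induction n with
  | zero => simp only [zero_add, pow_one, pow_zero, mul_one, mul_assoc, h.pp_assoc]
  | succ n ih =>
    rw [pow_succ, ih, pow_succ (p * c * p)]
    simp only [mul_assoc, h.pp_assoc, h.cc_assoc]

theorem p_mul_pcp_pow (n : ℕ) : p * (p * c * p) ^ (n + 1) = (p * c * p) ^ (n + 1) := by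
  rw [pow_succ', ← mul_assoc, h.p_mul_pcp]

theorem pcp_pow_mul_p (n : ℕ) : (p * c * p) ^ (n + 1) * p = (p * c * p) ^ (n + 1) := by
  rw [pow_succ, mul_assoc, h.pcp_mul_p]

theorem cpc_pow_sub (n : ℕ) : (c * p * c) ^ (n + 2) - c * p * c =
    c * p * ((p * c * p) ^ (n + 1) - p) * (p * c) := by
  rw [h.cpc_pow, mul_sub, sub_mul]
  congr 1
  simp only [mul_assoc, h.pp, h.pp_assoc]

end IdempotentTriple

end Algebra

/-! ### Traces and index for projections with nuclear commutator products. -/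

section IndexFormula

variable {E : Type} [NormedAddCommGroup E] [InnerProductSpace ℂ E] [CompleteSpace E]

theorem exp_smul_mul_exp_neg_smul (z : ℂ) (A : E →L[ℂ] E) :
    NormedSpace.exp (z • A) * NormedSpace.exp (-z • A) = 1 := by
  let _ : NormedAlgebra ℚ (E →L[ℂ] E) := NormedAlgebra.restrictScalars ℚ ℂ _
  rw [← NormedSpace.exp_add_of_commute (((Commute.refl A).smul_right _).smul_left _)]
  simp

/-- Contractive idempotents `c`, `l`, `p` such that `c` and `l` commute and the products
of the commutators `[c, p]` and `[l, p]` are nuclear. -/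
structure NuclearTriple (c l p : E →L[ℂ] E) : Prop extends IdempotentTriple c l p where
  norm_c : ‖c‖ ≤ 1
  norm_p : ‖p‖ ≤ 1
  nuclear : IsNuclear ((c * p - p * c) * (l * p - p * l))
  nuclear' : IsNuclear ((l * p - p * l) * (c * p - p * c))

namespace NuclearTriple

variable {c l p : E →L[ℂ] E} (h : NuclearTriple c l p)
include h

omit [CompleteSpace E] in
theorem norm_cpc : ‖c * p * c‖ ≤ 1 :=
  (norm_mul_le _ _).trans (mul_le_one₀ ((norm_mul_le _ _).trans
    (mul_le_one₀ h.norm_c (norm_nonneg _) h.norm_p)) (norm_nonneg _) h.norm_c)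

omit [CompleteSpace E] in
theorem norm_pcp : ‖p * c * p‖ ≤ 1 :=
  (norm_mul_le _ _).trans (mul_le_one₀ ((norm_mul_le _ _).trans
    (mul_le_one₀ h.norm_p (norm_nonneg _) h.norm_c)) (norm_nonneg _) h.norm_p)

theorem isNuclear_commutator_cpc_mul :
    IsNuclear ((c * p * c * l - l * (c * p * c)) * (c * p * c - (c * p * c) ^ 2)) := by
  rw [h.commutator_cpc_mul]
  exact (h.nuclear'.mul_left _).mul_right _

theorem isNuclear_commutator_cpc_sub_sq :
    IsNuclear ((c * p * c - (c * p * c) ^ 2) * l - l * (c * p * c - (c * p * c) ^ 2)) := by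
  rw [h.commutator_cpc_sub_sq]
  exact ((((h.nuclear.mul_left _).sub (h.nuclear.mul_right _)).add
    (h.nuclear'.mul_left _)).sub (h.nuclear'.mul_right _)).mul_left _

theorem isNuclear_commutator_pcp_mul :
    IsNuclear ((p * c * p * l - l * (p * c * p)) * (p * c * p - (p * c * p) ^ 2)) := by
  rw [h.commutator_pcp_mul]
  exact ((h.nuclear'.mul_left _).mul_right _).add (h.nuclear'.mul_right _)

theorem isNuclear_commutator_pcp_sub_sq :
    IsNuclear ((p * c * p - (p * c * p) ^ 2) * l - l * (p * c * p - (p * c * p) ^ 2)) := by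
  rw [h.commutator_pcp_sub_sq]
  exact (((((h.nuclear.mul_left _).sub (h.nuclear.mul_right _)).add
    (h.nuclear'.mul_left _)).sub (h.nuclear'.mul_right _)).mul_left _).add (h.nuclear'.mul_right _)

theorem isNuclear_commutator_compressions :
    IsNuclear (p * c * p * (p * l * p) - p * l * p * (p * c * p)) := by
  rw [h.commutator_compressions]
  exact ((h.nuclear.sub h.nuclear').mul_left _).mul_right _

theorem trace_commutator_compressions :
    trace (p * c * p * (p * l * p) - p * l * p * (p * c * p)) =
      trace (p * ((c * p - p * c) * (l * p - p * l) - (l * p - p * l) * (c * p - p * c))) := by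
  rw [h.commutator_compressions, trace_mul_comm ((h.nuclear.sub h.nuclear').mul_left _),
    ← mul_assoc, h.pp]

/-- For B = pcp and Y = B^{n+1} - B one has [Y,plp] = p[Y,l]p, where [Y,l] is nuclear and traceless
as a commutator with the idempotent l. Compression by p keeps the trace, so passing from B to
B^{n+1} changes nothing. -/
theorem trace_commutator_pow_compressions (n : ℕ) :
    trace ((p * c * p) ^ (n + 1) * (p * l * p) - p * l * p * (p * c * p) ^ (n + 1)) =
      trace (p * c * p * (p * l * p) - p * l * p * (p * c * p)) := by
  set B := p * c * p with hB
  set M := p * l * p with hM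
  set Y := B ^ (n + 1) - B with hY
  have hYp : Y * p = Y := by rw [hY, sub_mul, h.pcp_pow_mul_p, h.pcp_mul_p]
  have hpY : p * Y = Y := by rw [hY, mul_sub, h.p_mul_pcp_pow, h.p_mul_pcp]
  have hYl : IsNuclear (Y * l - l * Y) := by
    obtain ⟨κ, hκ⟩ := h.isNuclear_commutator_pcp_mul
    obtain ⟨κ', hκ'⟩ := h.isNuclear_commutator_pcp_sub_sq
    exact (NuclearBound.commutator_pow_sub h.norm_pcp (hκ.mono (le_max_left κ κ'))
      (hκ'.mono (le_max_right κ κ')) n).isNuclear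
  set Z := Y * l - l * Y with hZ
  have hYM : Y * M - M * Y = p * Z * p := by
    have : p * Z * p = (p * Y) * l * p - p * l * (Y * p) := by rw [hZ]; noncomm_ring
    rw [this, hYp, hpY]
    calc Y * M - M * Y = (Y * p) * l * p - p * l * (p * Y) := by rw [hM]; noncomm_ring
      _ = _ := by rw [hYp, hpY]
  -- This block of Z maps into the range of p and kills it, so its trace is zero by cyclicity.
  have h1 : Z * (1 - p) = p * (Z * (1 - p)) := by
    have e1 : Z * (1 - p) = Y * l * (1 - p) - l * (Y - Y * p) := by rw [hZ]; noncomm_ring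
    have e2 : p * (Z * (1 - p)) = (p * Y) * l * (1 - p) - p * l * (Y - Y * p) := by
      rw [hZ]; noncomm_ring
    rw [e2, e1, hYp, hpY]; simp
  have h2 : trace (Z * (1 - p)) = 0 := by
    have : Z * (1 - p) * p = 0 := by
      have hp : (1 - p) * p = 0 := by rw [sub_mul, one_mul, h.pp, sub_self]
      rw [mul_assoc, hp, mul_zero]
    rw [h1, ← trace_mul_comm (hYl.mul_right _), this, trace_zero]
  have h3 : trace (p * Z * p) = 0 := by
    rw [trace_mul_comm (hYl.mul_left p), ← mul_assoc, h.pp, ← trace_mul_comm hYl]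
    have : Z * p = Z - Z * (1 - p) := by noncomm_ring
    rw [this, trace_sub hYl (hYl.mul_right _), h2, sub_zero, hZ,
      trace_commutator_idempotent h.ll hYl]
  have h4 : B ^ (n + 1) * M - M * B ^ (n + 1) = (B * M - M * B) + (Y * M - M * Y) := by
    rw [hY]; noncomm_ring
  rw [h4, hYM, trace_add h.isNuclear_commutator_compressions ((hYl.mul_left _).mul_right _), h3,
    add_zero]

theorem trace_commutator_compressions_mul_pow (n : ℕ) :
    trace ((p * c * p * (p * l * p) - p * l * p * (p * c * p)) * (p * c * p) ^ n) =
      1 / (n + 1) * trace (p * c * p * (p * l * p) - p * l * p * (p * c * p)) := by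
  have h1 := trace_pow_mul_commutator_pow_mul (G := 1) h.norm_pcp (by simp)
    (by simpa using h.isNuclear_commutator_compressions) n 0
  simp only [pow_zero, one_mul, mul_one, zero_add] at h1
  rw [h.trace_commutator_pow_compressions n] at h1
  rw [h1]
  have : (n + 1 : ℂ) ≠ 0 := by exact_mod_cast n.succ_ne_zero
  field_simp

theorem isNuclear_commutator_cpc_mul_pow_sub (n : ℕ) :
    IsNuclear ((c * p * c * l - l * (c * p * c)) * (c * p) * ((p * c * p) ^ (n + 1) - p)) := by
  have h0 : IsNuclear ((c * p * c * l - l * (c * p * c)) * (c * p) * (p - p * c * p)) := by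
    rw [h.commutator_cpc_mul_sub]
    exact ((h.nuclear'.mul_left _).mul_right _).neg
  induction n with
  | zero => simpa only [zero_add, pow_one, ← mul_neg, neg_sub] using h0.neg
  | succ n ih =>
    have : (p * c * p) ^ (n + 1 + 1) - p =
        ((p * c * p) ^ (n + 1) - p) * (p * c * p) - (p - p * c * p) := by
      rw [sub_mul, h.p_mul_pcp, pow_succ _ (n + 1)]; abel
    rw [this, mul_sub, ← mul_assoc]
    exact (ih.mul_right _).sub h0

/-- Moving the last factor pc to the front replaces cpc by B = pcp and raises the power by one: the
leading power contributes 1/(n+2), the subtracted one is B¹ and contributes 1/2. At n = 0 both sides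
vanish. -/
theorem trace_commutator_cpc_mul_pow_sub (n : ℕ) :
    trace ((c * p * c * l - l * (c * p * c)) * ((c * p * c) ^ (n + 1) - c * p * c)) =
      (1 / (n + 2) - 1 / 2) * trace (p * c * p * (p * l * p) - p * l * p * (p * c * p)) := by
  rcases n with _ | n
  · simp [trace_zero]
  have e0 : (c * p * c * l - l * (c * p * c)) * ((c * p * c) ^ (n + 1 + 1) - c * p * c) =
      (c * p * c * l - l * (c * p * c)) * (c * p) * ((p * c * p) ^ (n + 1) - p) * (p * c) := by
    rw [h.cpc_pow_sub]; simp only [mul_assoc]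
  rw [e0, trace_mul_comm (h.isNuclear_commutator_cpc_mul_pow_sub n), ← mul_assoc,
    h.conj_commutator_cpc]
  set B := p * c * p with hB
  set M := p * l * p with hM
  set J := p * ((c * p - p * c) * (l * p - p * l)) * p with hJ
  have hJn : IsNuclear J := (h.nuclear.mul_left _).mul_right _
  have hBM := h.isNuclear_commutator_compressions
  have hFB : (B ^ (n + 1) - p) * B = B * (B ^ (n + 1) - p) := by
    rw [sub_mul, mul_sub, h.p_mul_pcp, h.pcp_mul_p, ← pow_succ, ← pow_succ']
  have hF : (B ^ (n + 1) - p) * B = B ^ (n + 2) - B := by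
    rw [sub_mul, h.p_mul_pcp, ← pow_succ]
  set F := B ^ (n + 1) - p
  -- J is nuclear and F commutes with B, so cyclicity applies.
  have e1 : trace ((B * J - J * B) * F) = 0 := by
    rw [sub_mul, trace_sub ((hJn.mul_left _).mul_right _) ((hJn.mul_right _).mul_right _),
      mul_assoc B J F, ← trace_mul_comm (hJn.mul_right F), mul_assoc J F B, mul_assoc J B F, hFB,
      sub_self]
  have e2 : trace (B * (B * M - M * B) * F) =
      trace ((B * M - M * B) * B ^ (n + 2)) - trace ((B * M - M * B) * B ^ 1) := by
    rw [mul_assoc, ← trace_mul_comm (hBM.mul_right F), mul_assoc, hF, mul_sub,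
      trace_sub (hBM.mul_right _) (hBM.mul_right _), pow_one]
  rw [sub_mul, trace_sub ((hBM.mul_left _).mul_right _)
    (((hJn.mul_left _).sub (hJn.mul_right _)).mul_right _), e1, e2,
    h.trace_commutator_compressions_mul_pow, h.trace_commutator_compressions_mul_pow]
  simp only [← hB, ← hM]
  push_cast
  ring_nf

/-- The trace that computes the index of the Kitaev operator. -/
theorem trace_commutator_exp_mul_exp_neg {z : ℂ} (hz : Complex.exp z = 1) (hz0 : z ≠ 0) :
    trace ((NormedSpace.exp (z • (c * p * c)) * l - l * NormedSpace.exp (z • (c * p * c))) *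
        NormedSpace.exp (-z • (c * p * c))) =
      z * trace (p * ((c * p - p * c) * (l * p - p * l) -
        (l * p - p * l) * (c * p - p * c))) := by
  rw [← h.trace_commutator_compressions]
  have hA := h.norm_cpc
  have hq := h.isNuclear_commutator_cpc_mul
  have hq' := h.isNuclear_commutator_cpc_sub_sq
  have htr := h.trace_commutator_cpc_mul_pow_sub
  set A := c * p * c with hAdef
  have hz' : Complex.exp (-z) = 1 := by rw [Complex.exp_neg, hz, inv_one]
  set u := NormedSpace.exp (z • A) with hu
  set v := NormedSpace.exp (-z • A) with hv
  have hcomm : Commute A v := by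
    exact ((Commute.refl A).smul_right (-z)).exp_right
  have hvu : v * u = 1 := by
    have := exp_smul_mul_exp_neg_smul (-z) A
    rwa [neg_neg] at this
  have hZ := isNuclear_commutator_exp hz hA hq hq'
  have hX := (hasSum_trace_mul_exp_sub_one hz' hA hq).1
  have hXu := hasSum_trace_mul_exp_sub_one hz hA hq
  have hG : A * (v - 1) = (v - 1) * A := by
    rw [mul_sub, sub_mul, hcomm.eq]; simp
  have h1 := trace_commutator_exp_mul (z := z) hA hG hX
  rw [← hu] at h1 hZ hXu
  have h2 : (A * l - l * A) * (v - 1) * u = -((A * l - l * A) * (u - 1)) := by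
    have : (v - 1) * u = -(u - 1) := by rw [sub_mul, hvu, one_mul, neg_sub]
    rw [mul_assoc, this, mul_neg]
  -- The last summand is a traceless nuclear commutator; the factor v - 1 allows differentiation of
  -- the exponential under the trace.
  have h3 : (u * l - l * u) * v = (u * l - l * u) * (v - 1) + (u * l - l * u) := by noncomm_ring
  rw [h3, trace_add (hZ.mul_right _) hZ, trace_commutator_idempotent h.ll hZ, add_zero, h1, h2,
    trace_neg]
  congr 1
  -- The weights 1/(n+2) sum to -1, and the constant weight 1/2 contributes (e^z - 1)/2 = 0.
  have hs := ((hasSum_expCoeff_div hz0).sub ((hasSum_expCoeff z).mul_right (1 / 2))).mul_right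
    (trace (p * c * p * (p * l * p) - p * l * p * (p * c * p)))
  have := hXu.2.unique (hasSum_of_forall_eq hs fun n => by rw [htr]; ring)
  rw [this, hz]
  field_simp
  ring

/-- The index formula for the Kitaev operator. -/
theorem isFredholm_and_index {z : ℂ} (hz : Complex.exp z = 1) (hz0 : z ≠ 0) :
    (l * NormedSpace.exp (z • (c * p * c)) * l + (1 - l)).IsFredholm ∧
      ((l * NormedSpace.exp (z • (c * p * c)) * l + (1 - l) : E →L[ℂ] E).toLinearMap.index : ℂ) =
        z * trace (p * ((c * p - p * c) * (l * p - p * l) -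
          (l * p - p * l) * (c * p - p * c))) := by
  have hmain := h.trace_commutator_exp_mul_exp_neg hz hz0
  have hA := h.norm_cpc
  have hq := h.isNuclear_commutator_cpc_mul
  have hq' := h.isNuclear_commutator_cpc_sub_sq
  set A := c * p * c with hAdef
  have hz' : Complex.exp (-z) = 1 := by rw [Complex.exp_neg, hz, inv_one]
  have hZ := isNuclear_commutator_exp hz hA hq hq'
  have hZ' := isNuclear_commutator_exp hz' hA hq hq'
  set u := NormedSpace.exp (z • A) with hu
  set v := NormedSpace.exp (-z • A) with hv
  have huv : u * v = 1 := exp_smul_mul_exp_neg_smul z A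
  have hvu : v * u = 1 := by
    have := exp_smul_mul_exp_neg_smul (-z) A
    rwa [neg_neg] at this
  have hll := h.ll
  have hll' := h.toIdempotentTriple.ll_assoc
  -- The defect is l a (1-l) b l, and (1-l)bl = (1-l)[b,l] because (1-l)l = 0.
  have key : ∀ a b : E →L[ℂ] E, a * b = 1 →
      1 - (l * a * l + (1 - l)) * (l * b * l + (1 - l)) =
        l * (a * ((1 - l) * (b * l - l * b)) * l) := by
    intro a b hab
    have hab' : ∀ x, a * (b * x) = x := fun x => by rw [← mul_assoc, hab, one_mul]
    simp only [mul_sub, sub_mul, mul_add, add_mul, one_mul, mul_one, mul_assoc, hll, hll', hab']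
    abel
  set Z := u * l - l * u with hZdef
  have n1 : IsNuclear (v * ((1 - l) * Z)) := (hZ.mul_left _).mul_left _
  have n2 : IsNuclear (u * ((1 - l) * (v * l - l * v))) := (hZ'.mul_left _).mul_left _
  have k1 := key v u hvu
  have k2 := key u v huv
  have f1 : IsNuclear (1 - (l * v * l + (1 - l)) * (l * u * l + (1 - l))) := by
    rw [k1]; exact (n1.mul_right _).mul_left _
  have f2 : IsNuclear (1 - (l * u * l + (1 - l)) * (l * v * l + (1 - l))) := by
    rw [k2]; exact (n2.mul_right _).mul_left _
  refine ⟨isFredholm_of_isNuclear f1 f2, ?_⟩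
  rw [index_eq_trace_sub_trace f1 f2, k1, k2, ← hmain]
  have t1 : trace (l * (v * ((1 - l) * Z) * l)) = trace ((1 - l) * Z * v) := by
    rw [← trace_mul_comm (n1.mul_right _), mul_assoc _ l l, hll]
    have : v * ((1 - l) * Z) * l = v * ((1 - l) * Z) := by
      simp only [hZdef, mul_sub, sub_mul, one_mul, mul_assoc, hll, hll']
      abel
    rw [this, trace_mul_comm (hZ.mul_left _)]
  have t2 : trace (l * (u * ((1 - l) * (v * l - l * v)) * l)) = -trace (l * Z * v) := by
    have e : l * (u * ((1 - l) * (v * l - l * v)) * l) = -(l * (Z * v * l)) := by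
      simp only [hZdef, mul_sub, sub_mul, one_mul, mul_assoc, hll, hll']
      abel
    rw [e, trace_neg, ← trace_mul_comm ((hZ.mul_right _).mul_right _), mul_assoc _ l l, hll,
      trace_mul_comm (hZ.mul_right _), mul_assoc]
  -- The two defects contribute the 1-l and l blocks of Zv, which add up to Zv.
  rw [t1, t2, sub_neg_eq_add, ← trace_add ((hZ.mul_left _).mul_right _)
    ((hZ.mul_left _).mul_right _)]
  congr 1
  noncomm_ring

end NuclearTriple
end IndexFormula

/-! ### Summation over the lattice and transversality -/

section Lattice

open Filter Topology

theorem norm_le_norm_latticePoint (x : ℤ × ℤ) : ‖![x.1, x.2]‖ ≤ ‖latticePoint x‖ := by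
  rw [pi_norm_le_iff_of_nonneg (norm_nonneg _)]
  intro i
  refine le_trans (le_of_eq ?_) (PiLp.norm_apply_le (latticePoint x) i)
  fin_cases i <;> simp [latticePoint, Int.norm_eq_abs]

theorem latticePoint_sub (x y : ℤ × ℤ) :
    latticePoint x - latticePoint y = latticePoint (x - y) := by
  ext i
  fin_cases i <;> simp [latticePoint]

theorem tendsto_norm_latticePoint : Tendsto (fun x => ‖latticePoint x‖) cofinite atTop := by
  have h : Tendsto (fun x : ℤ × ℤ => ‖![x.1, x.2]‖) cofinite atTop := by
    have h1 : Tendsto (fun v : Fin 2 → ℤ => ‖v‖) cofinite atTop := by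
      rw [← cocompact_eq_cofinite]
      exact tendsto_norm_cocompact_atTop
    exact h1.comp (finTwoArrowEquiv ℤ).symm.injective.tendsto_cofinite
  exact tendsto_atTop_mono norm_le_norm_latticePoint h

theorem summable_norm_latticePoint_rpow : Summable fun x => ‖latticePoint x‖ ^ (-3 : ℝ) := by
  have h := (finTwoArrowEquiv ℤ).symm.summable_iff.2
    (EisensteinSeries.summable_one_div_norm_rpow (k := 3) (by norm_num))
  refine Summable.of_norm_bounded_eventually h ?_
  filter_upwards [(tendsto_norm_latticePoint.comp tendsto_id).eventually_gt_atTop 0,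
    (finTwoArrowEquiv ℤ).symm.injective.tendsto_cofinite.eventually
      (eventually_cofinite_ne (0 : Fin 2 → ℤ))] with x hx hx0
  rw [Real.norm_of_nonneg (by positivity)]
  exact Real.rpow_le_rpow_of_nonpos (norm_pos_iff.2 hx0) (norm_le_norm_latticePoint x)
    (by norm_num)

theorem summable_exp_neg_rpow {α c : ℝ} (hα : 0 < α) (hc : 0 < c) :
    Summable fun x => Real.exp (-α * ‖latticePoint x‖ ^ c) := by
  refine summable_of_isBigO summable_norm_latticePoint_rpow ?_
  have h1 := (isLittleO_exp_neg_mul_rpow_atTop hα (-3 / c)).isBigO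
  have h2 := h1.comp_tendsto ((tendsto_rpow_atTop hc).comp tendsto_norm_latticePoint)
  refine h2.congr (fun x => rfl) fun x => ?_
  simp only [Function.comp]
  rw [← Real.rpow_mul (norm_nonneg _), mul_div_cancel₀ _ hc.ne']

theorem summable_exp_neg_norm {α : ℝ} (hα : 0 < α) :
    Summable fun x => Real.exp (-α * ‖latticePoint x‖) := by
  simpa using summable_exp_neg_rpow hα one_pos

theorem summable_exp_neg_dist {α : ℝ} (hα : 0 < α) (y : ℤ × ℤ) :
    Summable (fun x => Real.exp (-α * ‖latticePoint x - latticePoint y‖)) ∧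
      ∑' x, Real.exp (-α * ‖latticePoint x - latticePoint y‖) =
        ∑' x, Real.exp (-α * ‖latticePoint x‖) := by
  simp only [latticePoint_sub]
  exact ⟨(Equiv.subRight y).summable_iff.2 (summable_exp_neg_norm hα),
    (Equiv.subRight y).tsum_eq fun x => Real.exp (-α * ‖latticePoint x‖)⟩

theorem AreTransverse.exists_rpow_le {U V : Set Plane} (h : AreTransverse U V) :
    ∃ c : ℝ, 0 < c ∧ ∀ᶠ x : Plane in Bornology.cobounded Plane,
      ENNReal.ofReal (‖x‖ ^ c) ≤ Psi U V x := by
  obtain ⟨c, hc0, hc⟩ := EReal.lt_iff_exists_real_btwn.1 h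
  refine ⟨c, by exact_mod_cast hc0, ?_⟩
  filter_upwards [eventually_lt_of_lt_liminf hc, tendsto_norm_cobounded_atTop.eventually_gt_atTop 1]
    with x hx hx1
  have hlog : 0 < Real.log ‖x‖ := Real.log_pos hx1
  rw [EReal.lt_div_iff (by exact_mod_cast hlog) (EReal.coe_ne_top _)] at hx
  rw [← ENNReal.log_le_log_iff, ENNReal.log_ofReal_of_pos (by positivity),
    Real.log_rpow (by positivity)]
  exact_mod_cast hx.le

/-- The segment from y to x meets the frontier; otherwise the interiors of U and of its complement
would disconnect it. -/
theorem infEDist_frontier_le {U : Set Plane} {x y : Plane} (h : ¬(x ∈ U ↔ y ∈ U)) :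
    Metric.infEDist y (frontier U) ≤ ENNReal.ofReal ‖x - y‖ := by
  have hne : (segment ℝ y x ∩ frontier U).Nonempty := by
    have hc : IsPreconnected (segment ℝ y x) := (convex_segment y x).isPreconnected
    by_contra hcon
    have hmem : ∀ w ∈ segment ℝ y x, (w ∈ U → w ∈ interior U) ∧ (w ∉ U → w ∈ interior Uᶜ) := by
      refine fun w hw => ⟨fun hwU => ?_, fun hwU => ?_⟩
      · by_contra hi
        exact hcon ⟨w, hw, subset_closure hwU, hi⟩
      · by_contra hi
        rw [interior_compl, Set.mem_compl_iff, not_not] at hi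
        exact hcon ⟨w, hw, hi, fun h' => hwU (interior_subset h')⟩
    have hx := hmem x (right_mem_segment ℝ y x)
    have hy := hmem y (left_mem_segment ℝ y x)
    have hcover : segment ℝ y x ⊆ interior U ∪ interior Uᶜ := fun w hw => by
      by_cases hwU : w ∈ U
      · exact Or.inl ((hmem w hw).1 hwU)
      · exact Or.inr ((hmem w hw).2 hwU)
    have hboth : (segment ℝ y x ∩ interior U).Nonempty ∧
        (segment ℝ y x ∩ interior Uᶜ).Nonempty := by
      by_cases hxU : x ∈ U
      · have hyU : y ∉ U := fun h' => h (by simp [hxU, h'])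
        exact ⟨⟨x, right_mem_segment ℝ y x, hx.1 hxU⟩, ⟨y, left_mem_segment ℝ y x, hy.2 hyU⟩⟩
      · have hyU : y ∈ U := by
          by_contra h'
          exact h (by simp [hxU, h'])
        exact ⟨⟨y, left_mem_segment ℝ y x, hy.1 hyU⟩, ⟨x, right_mem_segment ℝ y x, hx.2 hxU⟩⟩
    obtain ⟨w, -, hw1, hw2⟩ := hc _ _ isOpen_interior isOpen_interior hcover hboth.1 hboth.2
    exact interior_subset hw2 (interior_subset hw1)
  obtain ⟨w, hw, hwU⟩ := hne
  refine (Metric.infEDist_le_edist_of_mem hwU).trans ?_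
  rw [edist_dist, ← dist_eq_norm, dist_comm x y]
  refine ENNReal.ofReal_le_ofReal ?_
  have := dist_add_dist_of_mem_segment hw
  linarith [dist_nonneg (x := w) (y := x)]

end Lattice

/-! ### Multiplication by characteristic functions -/

section Lam

variable {m : ℕ}

open Classical in
theorem Lam_apply (S : Set Plane) (f : Hilb m) (x : ℤ × ℤ) :
    Lam m S f x = if latticePoint x ∈ S then f x else 0 := by
  rw [Lam, lp.mapCLM_apply_coe]
  split_ifs <;> simp

theorem norm_Lam_le (S : Set Plane) : ‖Lam m S‖ ≤ 1 := lp.norm_mapCLM_le _ _ _ _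

theorem Lam_mul_self (S : Set Plane) : Lam m S * Lam m S = Lam m S := by
  refine ContinuousLinearMap.ext fun f => lp.ext (funext fun x => ?_)
  simp only [mul_apply_eq_comp, Lam_apply]
  split_ifs <;> rfl

theorem Lam_mul_comm (S T : Set Plane) : Lam m S * Lam m T = Lam m T * Lam m S := by
  refine ContinuousLinearMap.ext fun f => lp.ext (funext fun x => ?_)
  simp only [mul_apply_eq_comp, Lam_apply]
  split_ifs <;> rfl

theorem isSelfAdjoint_Lam (S : Set Plane) : IsSelfAdjoint (Lam m S) := by
  rw [ContinuousLinearMap.isSelfAdjoint_iff_isSymmetric]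
  intro f g
  simp only [ContinuousLinearMap.coe_coe, lp.inner_eq_tsum, Lam_apply]
  refine tsum_congr fun x => ?_
  split_ifs <;> simp

open Classical in
theorem Lam_single (S : Set Plane) (y : ℤ × ℤ) (v : EuclideanSpace ℂ (Fin m)) :
    Lam m S (lp.single 2 y v) = if latticePoint y ∈ S then lp.single 2 y v else 0 := by
  refine lp.ext (funext fun x => ?_)
  rw [Lam_apply]
  by_cases hxy : x = y
  · subst hxy; split_ifs <;> simp
  · split_ifs <;> simp [hxy]

theorem norm_single (x : ℤ × ℤ) (v : EuclideanSpace ℂ (Fin m)) :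
    ‖(lp.single 2 x v : Hilb m)‖ = ‖v‖ :=
  lp.norm_single (p := 2) (E := fun _ : ℤ × ℤ => EuclideanSpace ℂ (Fin m)) (by simp) x v

theorem hasSum_single (f : Hilb m) : HasSum (fun x => (lp.single 2 x (f x) : Hilb m)) f :=
  lp.hasSum_single (p := 2) (by simp) f

theorem norm_le_tsum_norm {f : Hilb m} (hf : Summable fun x => ‖f x‖) : ‖f‖ ≤ ∑' x, ‖f x‖ :=
  (hasSum_single f).norm_le_of_bounded hf.hasSum fun x => (norm_single x (f x)).le

theorem kernel_apply (A : Op m) (x y : ℤ × ℤ) (v : EuclideanSpace ℂ (Fin m)) :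
    kernel A x y v = A (lp.single 2 y v) x := rfl

/-- The entry vanishes unless x and y lie on different sides of the frontier, and then ‖x - y‖ ≥ t.
Half of the decay rate pays for t, the other half is kept for summing over x. -/
theorem norm_commutator_single_apply_le (P : Op m) (U : Set Plane) {ν t : ℝ} (hν : 0 < ν)
    {y : ℤ × ℤ} (hP : ∀ x,
      ‖kernel P x y‖ ≤ ν⁻¹ * Real.exp (-ν * ‖latticePoint x - latticePoint y‖))
    (ht : ENNReal.ofReal t ≤ Metric.infEDist (latticePoint y) (frontier U))
    (v : EuclideanSpace ℂ (Fin m)) (x : ℤ × ℤ) :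
    ‖(Lam m U * P - P * Lam m U) (lp.single 2 y v) x‖ ≤
      ν⁻¹ * Real.exp (-(ν / 2) * t) *
        Real.exp (-(ν / 2) * ‖latticePoint x - latticePoint y‖) * ‖v‖ := by
  by_cases h : latticePoint x ∈ U ↔ latticePoint y ∈ U
  · have : (Lam m U * P - P * Lam m U) (lp.single 2 y v) x = 0 := by
      rw [sub_apply, mul_apply_eq_comp, mul_apply_eq_comp, Lam_single, lp.coeFn_sub, Pi.sub_apply,
        Lam_apply]
      by_cases hy : latticePoint y ∈ U
      · simp [hy, h.2 hy]
      · simp [hy, show latticePoint x ∉ U from fun hx => hy (h.1 hx)]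
    rw [this, norm_zero]
    positivity
  · have hd := ht.trans (infEDist_frontier_le h)
    rw [ENNReal.ofReal_le_ofReal_iff (norm_nonneg _)] at hd
    have : ‖(Lam m U * P - P * Lam m U) (lp.single 2 y v) x‖ = ‖kernel P x y v‖ := by
      rw [sub_apply, mul_apply_eq_comp, mul_apply_eq_comp, Lam_single, lp.coeFn_sub, Pi.sub_apply,
        Lam_apply, kernel_apply]
      by_cases hx : latticePoint x ∈ U <;> by_cases hy : latticePoint y ∈ U
      · exact absurd (by simp [hx, hy]) h
      · simp [hx, hy]
      · simp [hx, hy]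
      · exact absurd (by simp [hx, hy]) h
    rw [this]
    refine ((kernel P x y).le_opNorm v).trans ?_
    gcongr
    refine (hP x).trans ?_
    rw [mul_assoc, ← Real.exp_add]
    gcongr
    nlinarith

theorem IsLocal.exists_norm_commutator_le {P : Op m} (hP : IsLocal P) :
    ∃ K β : ℝ, 0 < K ∧ 0 < β ∧ ∀ (U : Set Plane) (y : ℤ × ℤ) (t : ℝ),
      ENNReal.ofReal t ≤ Metric.infEDist (latticePoint y) (frontier U) →
      ∀ v : EuclideanSpace ℂ (Fin m),
        ‖(Lam m U * P - P * Lam m U) (lp.single 2 y v)‖ ≤ K * Real.exp (-β * t) * ‖v‖ := by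
  obtain ⟨ν, hν, hP⟩ := hP
  have hν2 : 0 < ν / 2 := by positivity
  have hs := summable_exp_neg_norm hν2
  refine ⟨ν⁻¹ * ∑' x, Real.exp (-(ν / 2) * ‖latticePoint x‖), ν / 2, ?_, hν2, ?_⟩
  · have := hs.tsum_pos (fun x => (Real.exp_pos _).le) 0 (Real.exp_pos _)
    positivity
  intro U y t ht v
  obtain ⟨h1, h2⟩ := summable_exp_neg_dist hν2 y
  have hb := norm_commutator_single_apply_le P U hν (fun x => hP x y) ht v
  have hs' := (h1.mul_left (ν⁻¹ * Real.exp (-(ν / 2) * t))).mul_right ‖v‖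
  have hsum := Summable.of_nonneg_of_le (fun x => norm_nonneg _) hb hs'
  refine (norm_le_tsum_norm hsum).trans ((hsum.tsum_le_tsum hb hs').trans (le_of_eq ?_))
  rw [tsum_mul_right, tsum_mul_left, h2]
  ring

/-- A product `S * T` is nuclear if the columns of `S` and `T†` are jointly summable. -/
theorem isNuclear_mul_of_summable {S T : Op m}
    (h : Summable fun q : (ℤ × ℤ) × Fin m =>
      ‖S (lp.single 2 q.1 (EuclideanSpace.single q.2 1))‖ *
        ‖star T (lp.single 2 q.1 (EuclideanSpace.single q.2 1))‖) : IsNuclear (S * T) := by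
  refine IsNuclearRep.isNuclear (ι := (ℤ × ℤ) × Fin m)
    (a := fun q => S (lp.single 2 q.1 (EuclideanSpace.single q.2 1)))
    (b := fun q => star T (lp.single 2 q.1 (EuclideanSpace.single q.2 1))) ⟨h, fun f => ?_⟩
  have hs : Summable fun q : (ℤ × ℤ) × Fin m =>
      ⟪star T (lp.single 2 q.1 (EuclideanSpace.single q.2 (1 : ℂ))), f⟫_ℂ •
        S (lp.single 2 q.1 (EuclideanSpace.single q.2 1)) := by
    refine Summable.of_norm_bounded (h.mul_right ‖f‖) fun q => ?_
    rw [norm_smul, mul_comm ‖S _‖, mul_assoc, mul_comm ‖S _‖, ← mul_assoc]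
    gcongr
    exact norm_inner_le_norm _ _
  have h1 : ∀ y, HasSum (fun j => ⟪star T (lp.single 2 y (EuclideanSpace.single j (1 : ℂ))), f⟫_ℂ •
      S (lp.single 2 y (EuclideanSpace.single j 1))) (S (lp.single 2 y (T f y))) := by
    intro y
    have : S (lp.single 2 y (T f y)) =
        ∑ j, ⟪star T (lp.single 2 y (EuclideanSpace.single j (1 : ℂ))), f⟫_ℂ •
          S (lp.single 2 y (EuclideanSpace.single j 1)) := by
      have hv : T f y = ∑ j, (T f y) j • EuclideanSpace.single j (1 : ℂ) := by
        ext i; simp [Finset.sum_apply, Pi.single_apply]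
      have hc : ∀ j, ⟪star T (lp.single 2 y (EuclideanSpace.single j (1 : ℂ))), f⟫_ℂ =
          (T f y) j := fun j => by
        rw [ContinuousLinearMap.star_eq_adjoint, ContinuousLinearMap.adjoint_inner_left,
          lp.inner_single_left, EuclideanSpace.inner_single_left]
        simp
      simp only [hc]
      have := congrArg (fun v => S (lp.singleContinuousLinearMap ℂ
        (fun _ : ℤ × ℤ => EuclideanSpace ℂ (Fin m)) 2 y v)) hv
      simpa only [map_sum, map_smul, lp.singleContinuousLinearMap_apply] using this
    rw [this]
    exact hasSum_fintype _
  have h2 := hs.hasSum.prod_fiberwise h1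
  have h3 := S.hasSum (hasSum_single (T f))
  rw [mul_apply_eq_comp, ← h2.unique h3]
  exact hs.hasSum

theorem summable_norm_commutator_mul {U V : Set Plane} (hUV : AreTransverse U V) {P : Op m}
    (hloc : IsLocal P) : Summable fun q : (ℤ × ℤ) × Fin m =>
      ‖(Lam m U * P - P * Lam m U) (lp.single 2 q.1 (EuclideanSpace.single q.2 1))‖ *
        ‖(Lam m V * P - P * Lam m V) (lp.single 2 q.1 (EuclideanSpace.single q.2 1))‖ := by
  obtain ⟨K, β, hK, hβ, hb⟩ := hloc.exists_norm_commutator_le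
  obtain ⟨c, hc, hΨ⟩ := hUV.exists_rpow_le
  have hs := (summable_exp_neg_rpow (half_pos hβ) hc).mul_left (K * K * Real.exp (β / 2))
  have hcol : ∀ j : Fin m, Summable fun y : ℤ × ℤ =>
      ‖(Lam m U * P - P * Lam m U) (lp.single 2 y (EuclideanSpace.single j 1))‖ *
        ‖(Lam m V * P - P * Lam m V) (lp.single 2 y (EuclideanSpace.single j 1))‖ := by
    intro j
    refine Summable.of_norm_bounded_eventually hs ?_
    filter_upwards [(tendsto_norm_atTop_iff_cobounded.1 tendsto_norm_latticePoint).eventually hΨ]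
      with y hy
    rw [Real.norm_of_nonneg (by positivity)]
    have h0 : ∀ W : Set Plane,
        ‖(Lam m W * P - P * Lam m W) (lp.single 2 y (EuclideanSpace.single j 1))‖ ≤ K := by
      intro W
      simpa using hb W y 0 (by simp) (EuclideanSpace.single j 1)
    -- Chosen so that 1 + 2t = ‖y‖^c: the lower bound on Ψ forbids both distances from being below
    -- t. One commutator column then decays, and the other is bounded by K.
    set t := (‖latticePoint y‖ ^ c - 1) / 2 with ht
    have hexp : K * Real.exp (-β * t) * K =
        K * K * Real.exp (β / 2) * Real.exp (-(β / 2) * ‖latticePoint y‖ ^ c) := by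
      rw [mul_assoc (K * K), ← Real.exp_add, ht]
      ring_nf
    have ht' : ∀ W : Set Plane, ENNReal.ofReal t ≤ Metric.infEDist (latticePoint y) (frontier W) →
        ‖(Lam m W * P - P * Lam m W) (lp.single 2 y (EuclideanSpace.single j 1))‖ ≤
          K * Real.exp (-β * t) := by
      intro W hW
      simpa using hb W y t hW (EuclideanSpace.single j 1)
    rw [← hexp]
    by_cases hU : ENNReal.ofReal t ≤ Metric.infEDist (latticePoint y) (frontier U)
    · gcongr
      · exact ht' U hU
      · exact h0 V
    by_cases hV : ENNReal.ofReal t ≤ Metric.infEDist (latticePoint y) (frontier V)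
    · rw [mul_comm ‖_‖]
      gcongr
      · exact ht' V hV
      · exact h0 U
    exfalso
    push Not at hU hV
    have ht0 : 0 < t := ENNReal.ofReal_pos.1 (pos_of_gt hU)
    have hlt : Psi U V (latticePoint y) < 1 + ENNReal.ofReal t + ENNReal.ofReal t := by
      rw [Psi]
      exact ENNReal.add_lt_add (ENNReal.add_lt_add_left ENNReal.one_ne_top hU) hV
    have : 1 + ENNReal.ofReal t + ENNReal.ofReal t = ENNReal.ofReal (‖latticePoint y‖ ^ c) := by
      rw [← ENNReal.ofReal_one, ← ENNReal.ofReal_add zero_le_one ht0.le,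
        ← ENNReal.ofReal_add (by positivity) ht0.le]
      congr 1
      rw [ht]; ring
    rw [this] at hlt
    exact absurd hy (not_le.2 hlt)
  refine (summable_prod_of_nonneg fun q => by positivity).2 ⟨fun y => Summable.of_finite, ?_⟩
  simp only [tsum_fintype]
  exact summable_sum fun j _ => hcol j

theorem nuclearTriple_of_isLocal {U V : Set Plane} (hUV : AreTransverse U V) {P : Op m}
    (hP : IsStarProjection P) (hloc : IsLocal P) : NuclearTriple (Lam m U) (Lam m V) P := by
  -- A commutator of two self-adjoint operators is anti-self-adjoint, so one summability estimate
  -- serves both orders of the product.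
  have hstar : ∀ (W : Set Plane) (f : Hilb m),
      ‖star (Lam m W * P - P * Lam m W) f‖ = ‖(Lam m W * P - P * Lam m W) f‖ := by
    intro W f
    rw [star_sub, star_mul, star_mul, hP.isSelfAdjoint.star_eq, (isSelfAdjoint_Lam W).star_eq,
      ← neg_sub, neg_apply, norm_neg]
  have hs := summable_norm_commutator_mul hUV hloc
  exact
    { cc := Lam_mul_self U
      ll := Lam_mul_self V
      pp := hP.isIdempotentElem
      lc := Lam_mul_comm V U
      norm_c := norm_Lam_le U
      norm_p := hP.norm_le
      nuclear := isNuclear_mul_of_summable (hs.congr fun q => by rw [hstar])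
      nuclear' := isNuclear_mul_of_summable
        (hs.congr fun q => by rw [hstar, mul_comm (‖_‖ : ℝ)]) }

/-- The index theorem for a local projection. -/
theorem index_theorem_of_isLocal {U V : Set Plane} (hUV : AreTransverse U V) {P : Op m}
    (hP : IsStarProjection P) (hloc : IsLocal P) :
    (kitaevOp P U V).IsFredholm ∧ IsTraceClass (hallOp P U V) ∧
      (kitaevIndex P U V : ℂ) = 2 * Real.pi * hallConductance P U V := by
  have h := nuclearTriple_of_isLocal hUV hP hloc
  obtain ⟨h1, h2⟩ := h.isFredholm_and_index (z := 2 * Real.pi * Complex.I)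
    Complex.exp_two_pi_mul_I Complex.two_pi_I_ne_zero
  refine ⟨h1, ?_, ?_⟩
  · exact ((h.nuclear.sub h.nuclear').mul_left P).isTraceClass
  · rw [hallConductance, ← mul_assoc]
    exact h2

end Lam

/-! ### Fermi projections and similarity transformations -/

section FermiSimilarity

open Filter Topology Polynomial

/-- The Taylor coefficients of `(1 - w)^(-1/2)`. -/
theorem exists_invSqrt_series : ∃ c : ℕ → ℝ,
    (∀ r : ℝ, 0 ≤ r → r < 1 → Summable fun n => |c n| * r ^ n) ∧
      ∀ w : ℝ, 0 ≤ w → w < 1 → HasSum (fun n => c n * w ^ n) (1 / √(1 - w)) := by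
  have h := Real.one_div_one_sub_rpow_hasFPowerSeriesOnBall_zero (1 / 2)
  refine ⟨fun n => Ring.choose (1 / 2 + n - 1 : ℝ) n, fun r hr0 hr1 => ?_, fun w hw0 hw1 => ?_⟩
  · lift r to NNReal using hr0
    have hr : (r : ENNReal) < 1 := by exact_mod_cast hr1
    have := FormalMultilinearSeries.summable_norm_mul_pow _ (hr.trans_le h.r_le)
    simpa [FormalMultilinearSeries.ofScalars_norm] using this
  · have hw : w ∈ Metric.eball (0 : ℝ) 1 := by
      rw [Metric.mem_eball, edist_zero_right, Real.enorm_of_nonneg hw0]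
      exact ENNReal.ofReal_lt_one.2 hw1
    have := h.hasSum hw
    simp only [zero_add, FormalMultilinearSeries.ofScalars_apply_eq, smul_eq_mul] at this
    rwa [← Real.sqrt_eq_rpow] at this

variable {E : Type} [NormedAddCommGroup E] [InnerProductSpace ℂ E] [CompleteSpace E]

omit [CompleteSpace E] in
theorem aeval_conj {D D' : E →L[ℂ] E} (h' : D' * D = 1) (h : D * D' = 1) (H : E →L[ℂ] E)
    (q : ℝ[X]) : aeval (D * H * D') q = D * aeval H q * D' := by
  induction q using Polynomial.induction_on' with
  | add p q hp hq => rw [map_add, map_add, hp, hq, mul_add, add_mul]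
  | monomial n a =>
    have hpow : (D * H * D') ^ n = D * H ^ n * D' := by
      induction n with
      | zero => simp [h]
      | succ n ih =>
        rw [pow_succ, ih, pow_succ]
        calc D * H ^ n * D' * (D * H * D') = D * H ^ n * (D' * D) * H * D' := by
              simp only [mul_assoc]
          _ = _ := by rw [h', mul_one]; simp only [mul_assoc]
    rw [aeval_monomial, aeval_monomial, hpow, ← Algebra.smul_def, ← Algebra.smul_def,
      mul_smul_comm, smul_mul_assoc]

omit [CompleteSpace E] in
theorem norm_pow_le_pow {W : E →L[ℂ] E} {r : ℝ} (hW : ‖W‖ ≤ r) (n : ℕ) : ‖W ^ n‖ ≤ r ^ n := by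
  rcases n.eq_zero_or_pos with rfl | hn
  · rw [pow_zero, pow_zero]
    exact ContinuousLinearMap.norm_id_le
  · exact (norm_pow_le' W hn).trans (pow_le_pow_left₀ (norm_nonneg _) hW n)

/-- A polynomial approximation to the indicator function of `(-∞, e)`. -/
def fermiPoly (c : ℕ → ℝ) (e M : ℝ) (N : ℕ) : ℝ[X] :=
  C (1 / 2) * (1 - ∑ n ∈ Finset.range N,
    C (c n) * ((C M⁻¹ * (X - C e)) * (1 - (C M⁻¹ * (X - C e)) ^ 2) ^ n))

theorem eval_fermiPoly (c : ℕ → ℝ) (e M : ℝ) (N : ℕ) (x : ℝ) : (fermiPoly c e M N).eval x =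
    1 / 2 * (1 - ∑ n ∈ Finset.range N,
      c n * ((M⁻¹ * (x - e)) * (1 - (M⁻¹ * (x - e)) ^ 2) ^ n)) := by
  simp [fermiPoly, eval_finsetSum]

omit [CompleteSpace E] in
-- The bound is uniform in N and uses norms only, not self-adjointness, so it survives a similarity
-- transformation.
theorem norm_aeval_fermiPoly_le {c : ℕ → ℝ} {r : ℝ} (hc : Summable fun n => |c n| * r ^ n)
    (hr : 0 ≤ r) (e M : ℝ) (N : ℕ) (H : E →L[ℂ] E)
    (h1 : ‖M⁻¹ • (H - algebraMap ℝ (E →L[ℂ] E) e)‖ ≤ 2)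
    (h2 : ‖1 - (M⁻¹ • (H - algebraMap ℝ (E →L[ℂ] E) e)) ^ 2‖ ≤ r) :
    ‖aeval H (fermiPoly c e M N)‖ ≤ 1 / 2 * (1 + 2 * ∑' n, |c n| * r ^ n) := by
  set K := M⁻¹ • (H - algebraMap ℝ (E →L[ℂ] E) e) with hK
  have e1 : aeval H (fermiPoly c e M N) =
      (1 / 2 : ℝ) • (1 - ∑ n ∈ Finset.range N, c n • (K * (1 - K ^ 2) ^ n)) := by
    simp [fermiPoly, hK, Algebra.smul_def]
  rw [e1, norm_smul, Real.norm_of_nonneg (by norm_num)]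
  gcongr
  refine (norm_sub_le _ _).trans (add_le_add ContinuousLinearMap.norm_id_le ?_)
  refine (norm_sum_le _ _).trans ?_
  have hb : ∀ n ∈ Finset.range N, ‖c n • (K * (1 - K ^ 2) ^ n)‖ ≤ 2 * (|c n| * r ^ n) := by
    intro n _
    rw [norm_smul, Real.norm_eq_abs]
    have := (norm_mul_le K ((1 - K ^ 2) ^ n)).trans
      (mul_le_mul h1 (norm_pow_le_pow h2 n) (norm_nonneg _) zero_le_two)
    calc |c n| * ‖K * (1 - K ^ 2) ^ n‖ ≤ |c n| * (2 * r ^ n) := by gcongr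
      _ = _ := by ring
  refine (Finset.sum_le_sum hb).trans ?_
  rw [← Finset.mul_sum]
  gcongr
  exact hc.sum_le_tsum _ fun n _ => by positivity

/-- The Fermi projection stays bounded under similarity transformations that move the Hamiltonian
only a little. -/
theorem exists_norm_conj_fermiProjection_le {H : E →L[ℂ] E} {e : ℝ} (hH : IsSelfAdjoint H)
    (he : (e : ℂ) ∉ spectrum ℂ H) : ∃ ε C : ℝ, 0 < ε ∧ 0 < C ∧ ∀ D D' : E →L[ℂ] E,
      D' * D = 1 → D * D' = 1 → ‖D * H * D' - H‖ ≤ ε → ‖D * fermiProjection H e * D'‖ ≤ C := by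
  have he' : e ∉ spectrum ℝ H := fun h => he ((spectrum.algebraMap_mem_iff ℂ).2 h)
  obtain ⟨g, hg, hgap⟩ := Metric.isOpen_iff.1 (spectrum.isClosed (𝕜 := ℝ) H).isOpen_compl e he'
  have hgap' : ∀ x ∈ spectrum ℝ H, g ≤ |x - e| := fun x hx => by
    by_contra hlt
    exact hgap (by rw [Metric.mem_ball, Real.dist_eq]; linarith) hx
  obtain ⟨c, hc, hcs⟩ := exists_invSqrt_series
  -- Large enough that (H - e)/M has spectrum in [-1,1] and that the rescaled gap γ is at most 1.
  set M := ‖H‖ + |e| + 1 + g with hM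
  have hM0 : 0 < M := by positivity
  set γ := M⁻¹ * g with hγ
  have hγ0 : 0 < γ := by positivity
  have hγ1 : γ ≤ 1 := by
    rw [hγ, inv_mul_le_iff₀ hM0, mul_one, hM]
    have := norm_nonneg H
    have := abs_nonneg e
    linarith
  have hγ2 : γ ^ 2 ≤ 1 := pow_le_one₀ hγ0.le hγ1
  have hspec : ∀ x ∈ spectrum ℝ H, γ ≤ |M⁻¹ * (x - e)| ∧ |M⁻¹ * (x - e)| ≤ 1 := by
    intro x hx
    rw [abs_mul, abs_of_pos (inv_pos.2 hM0)]
    refine ⟨by rw [hγ]; gcongr; exact hgap' x hx, ?_⟩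
    rw [inv_mul_le_iff₀ hM0, mul_one]
    have h1 : |x| ≤ ‖H‖ := by
      have := spectrum.norm_le_norm_mul_of_mem hx
      exact this.trans (mul_le_of_le_one_right (norm_nonneg _) ContinuousLinearMap.norm_id_le)
    have h2 := abs_sub x e
    linarith
  have hsq : ∀ x ∈ spectrum ℝ H,
      0 ≤ 1 - (M⁻¹ * (x - e)) ^ 2 ∧ 1 - (M⁻¹ * (x - e)) ^ 2 ≤ 1 - γ ^ 2 := by
    intro x hx
    obtain ⟨h1, h2⟩ := hspec x hx
    rw [← sq_abs (M⁻¹ * (x - e))]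
    constructor <;> nlinarith [abs_nonneg (M⁻¹ * (x - e))]
  -- the polynomials converge uniformly on the spectrum
  have hunif : TendstoUniformlyOn (fun N x => (fermiPoly c e M N).eval x)
      (Set.indicator (Set.Iio e) fun _ => 1) atTop (spectrum ℝ H) := by
    have h1 := tendstoUniformlyOn_tsum_nat (s := spectrum ℝ H)
      (f := fun n x => c n * ((M⁻¹ * (x - e)) * (1 - (M⁻¹ * (x - e)) ^ 2) ^ n))
      (hc (1 - γ ^ 2) (by linarith) (by nlinarith)) (fun n x hx => ?_)
    · have huc : UniformContinuous fun t : ℝ => 1 / 2 * (1 - t) :=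
        ((uniformContinuous_const.sub uniformContinuous_id).const_mul' (1 / 2))
      have h2 := huc.comp_tendstoUniformlyOn h1
      refine (h2.congr (Eventually.of_forall fun N x hx => (eval_fermiPoly c e M N x).symm)).congr_right
        fun x hx => ?_
      obtain ⟨k1, k2⟩ := hspec x hx
      have hlt : 1 - (M⁻¹ * (x - e)) ^ 2 < 1 := by
        have : 0 < |M⁻¹ * (x - e)| ^ 2 := pow_pos (hγ0.trans_le k1) 2
        rw [sq_abs] at this; linarith
      -- For s = (x - e)/M the series of (1 - w)^{-1/2} at w = 1 - s², times s, is s/|s| = sign s.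
      have hs := (hcs _ (hsq x hx).1 hlt).mul_left (M⁻¹ * (x - e))
      rw [sub_sub_cancel, Real.sqrt_sq_eq_abs] at hs
      have hs' : ∑' n, c n * ((M⁻¹ * (x - e)) * (1 - (M⁻¹ * (x - e)) ^ 2) ^ n) =
          M⁻¹ * (x - e) * (1 / |M⁻¹ * (x - e)|) := by
        rw [← hs.tsum_eq]
        exact tsum_congr fun n => by ring
      simp only [Function.comp, hs']
      by_cases hxe : x < e
      · have hneg : M⁻¹ * (x - e) < 0 := mul_neg_of_pos_of_neg (inv_pos.2 hM0) (by linarith)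
        rw [Set.indicator_of_mem (show x ∈ Set.Iio e from hxe), abs_of_neg hneg]
        rw [one_div_neg_eq_neg_one_div, mul_neg, mul_one_div_cancel hneg.ne]
        norm_num
      · have hpos : 0 < M⁻¹ * (x - e) := by
          have : 0 < |x - e| := hg.trans_le (hgap' x hx)
          have : x - e ≠ 0 := abs_pos.1 this
          have : 0 < x - e := lt_of_le_of_ne (by linarith) this.symm
          positivity
        rw [Set.indicator_of_notMem (show x ∉ Set.Iio e from hxe), abs_of_pos hpos, mul_one_div_cancel hpos.ne']
        norm_num
    · obtain ⟨k1, k2⟩ := hspec x hx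
      obtain ⟨k3, k4⟩ := hsq x hx
      rw [Real.norm_eq_abs, abs_mul, abs_mul, abs_pow, abs_of_nonneg k3]
      gcongr
      calc |M⁻¹ * (x - e)| * (1 - (M⁻¹ * (x - e)) ^ 2) ^ n ≤ 1 * (1 - γ ^ 2) ^ n := by gcongr
        _ = _ := one_mul _
  have hlim : Tendsto (fun N => aeval H (fermiPoly c e M N)) atTop (𝓝 (fermiProjection H e)) := by
    have := tendsto_cfc_fun (a := H) hunif
      (Eventually.of_forall fun N => (fermiPoly c e M N).continuous.continuousOn)
    rw [fermiProjection]
    simpa only [cfc_polynomial _ H hH] using this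
  -- norm bounds for the normalized Hamiltonian
  set K := M⁻¹ • (H - algebraMap ℝ (E →L[ℂ] E) e) with hK
  have hKcfc : K = cfc (fun x => M⁻¹ * (x - e)) H := by
    have := cfc_polynomial (C M⁻¹ * (X - C e)) H hH
    simp only [eval_mul, eval_sub, eval_C, eval_X] at this
    rw [this, hK]
    simp [Algebra.smul_def]
  have hK1 : ‖K‖ ≤ 1 := by
    rw [hKcfc]
    exact norm_cfc_le zero_le_one fun x hx => (hspec x hx).2
  have hK2 : ‖1 - K ^ 2‖ ≤ 1 - γ ^ 2 := by
    have : 1 - K ^ 2 = cfc (fun x => 1 - (M⁻¹ * (x - e)) ^ 2) H := by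
      have := cfc_polynomial (1 - (C M⁻¹ * (X - C e)) ^ 2) H hH
      simp only [eval_mul, eval_sub, eval_C, eval_X, eval_one, eval_pow] at this
      rw [this, hK]
      simp [Algebra.smul_def]
    rw [this]
    refine norm_cfc_le (by linarith) fun x hx => ?_
    rw [Real.norm_of_nonneg (hsq x hx).1]
    exact (hsq x hx).2
  set r := 1 - γ ^ 2 / 2 with hr
  have hr0 : 0 ≤ r := by linarith
  have hr1 : r < 1 := by nlinarith
  have hS := hc r hr0 hr1
  -- If K moves by at most γ²/6, then K² moves by at most (2 + 1)γ²/6 = γ²/2, which keeps 1 - K²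
  -- within r < 1.
  refine ⟨M * (γ ^ 2 / 6), 1 / 2 * (1 + 2 * ∑' n, |c n| * r ^ n), by positivity, ?_, ?_⟩
  · have : 0 ≤ ∑' n, |c n| * r ^ n := tsum_nonneg fun n => by positivity
    positivity
  intro D D' h' h hclose
  set H' := D * H * D' with hH'
  set K' := M⁻¹ • (H' - algebraMap ℝ (E →L[ℂ] E) e) with hK'
  have hd : ‖K' - K‖ ≤ γ ^ 2 / 6 := by
    have : K' - K = M⁻¹ • (H' - H) := by rw [hK, hK', ← smul_sub]; congr 1; abel
    rw [this, norm_smul, Real.norm_of_nonneg (inv_pos.2 hM0).le, inv_mul_le_iff₀ hM0]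
    exact hclose
  have hK'1 : ‖K'‖ ≤ 2 := by
    calc ‖K'‖ = ‖(K' - K) + K‖ := by rw [sub_add_cancel]
      _ ≤ γ ^ 2 / 6 + 1 := (norm_add_le _ _).trans (add_le_add hd hK1)
      _ ≤ 2 := by linarith
  have hK'2 : ‖1 - K' ^ 2‖ ≤ r := by
    have e1 : 1 - K' ^ 2 = (1 - K ^ 2) - (K' * (K' - K) + (K' - K) * K) := by noncomm_ring
    rw [e1]
    have h1 := (norm_mul_le K' (K' - K)).trans
      (mul_le_mul hK'1 hd (norm_nonneg _) zero_le_two)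
    have h2 := (norm_mul_le (K' - K) K).trans
      (mul_le_mul hd hK1 (norm_nonneg _) (by positivity))
    calc _ ≤ ‖1 - K ^ 2‖ + ‖K' * (K' - K) + (K' - K) * K‖ := norm_sub_le _ _
      _ ≤ (1 - γ ^ 2) + (2 * (γ ^ 2 / 6) + γ ^ 2 / 6 * 1) :=
          add_le_add hK2 ((norm_add_le _ _).trans (add_le_add h1 h2))
      _ = r := by rw [hr]; ring
  have hlim' : Tendsto (fun N => D * aeval H (fermiPoly c e M N) * D') atTop
      (𝓝 (D * fermiProjection H e * D')) := (hlim.const_mul D).mul_const D'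
  refine le_of_tendsto hlim'.norm (Eventually.of_forall fun N => ?_)
  rw [← aeval_conj h' h]
  exact norm_aeval_fermiPoly_le hS hr0 e M N _ hK'1 hK'2

theorem isStarProjection_fermiProjection {H : E →L[ℂ] E} {e : ℝ}
    (he : (e : ℂ) ∉ spectrum ℂ H) : IsStarProjection (fermiProjection H e) := by
  have he' : e ∉ spectrum ℝ H := fun h => he ((spectrum.algebraMap_mem_iff ℂ).2 h)
  have hcont : ContinuousOn (Set.indicator (Set.Iio e) fun _ : ℝ => (1 : ℝ)) (spectrum ℝ H) := by
    intro x hx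
    have hxe : x ≠ e := fun h => he' (h ▸ hx)
    refine ContinuousAt.continuousWithinAt ?_
    refine continuousOn_const.continuousAt_indicator ?_
    rwa [frontier_Iio]
  refine ⟨?_, ?_⟩
  · rw [IsIdempotentElem, fermiProjection, ← cfc_mul _ _ H hcont hcont]
    congr 1
    ext x
    by_cases hx : x < e <;> simp [hx]
  · exact cfc_predicate _ _

end FermiSimilarity

/-! ### Locality of Fermi projections -/

section FermiLocal

variable {m : ℕ}

theorem norm_kernel_le (A : Op m) (x y : ℤ × ℤ) : ‖kernel A x y‖ ≤ ‖A‖ := by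
  refine ContinuousLinearMap.opNorm_le_bound _ (norm_nonneg _) fun v => ?_
  rw [kernel_apply]
  refine (lp.norm_apply_le_norm two_ne_zero _ x).trans ((A.le_opNorm _).trans ?_)
  rw [norm_single]

theorem hasSum_norm_sq (f : Hilb m) : HasSum (fun x => ‖f x‖ ^ 2) (‖f‖ ^ 2) := by
  have := lp.hasSum_norm (p := 2) (by simp) f
  simpa using this

/-- Schur's test for kernels dominated by a summable convolution kernel. -/
theorem norm_le_tsum_of_norm_kernel_le {A : Op m} {b : ℤ × ℤ → ℝ} (hb : Summable b)
    (hA : ∀ x y, ‖kernel A x y‖ ≤ b (x - y)) : ‖A‖ ≤ ∑' x, b x := by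
  have hb0 : ∀ x, 0 ≤ b x := fun x => by simpa using (norm_nonneg _).trans (hA x 0)
  set B := ∑' x, b x with hB
  have hB0 : 0 ≤ B := tsum_nonneg hb0
  have key : ∀ f g : Hilb m, ‖⟪g, A f⟫_ℂ‖ ≤ B * ((‖g‖ ^ 2 + ‖f‖ ^ 2) / 2) := by
    intro f g
    have hprod : ∀ h : Hilb m, HasSum (fun p : (ℤ × ℤ) × (ℤ × ℤ) => b p.1 * ‖h p.2‖ ^ 2)
        (B * ‖h‖ ^ 2) := fun h =>
      HasSum.mul (f := b) (g := fun x => ‖h x‖ ^ 2) hb.hasSum (hasSum_norm_sq h)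
        (Summable.mul_of_nonneg (f := b) (g := fun x => ‖h x‖ ^ 2) hb (hasSum_norm_sq h).summable
          hb0 fun _ => by positivity)
    let e₁ : (ℤ × ℤ) × (ℤ × ℤ) ≃ (ℤ × ℤ) × (ℤ × ℤ) :=
      { toFun p := (p.2 - p.1, p.2)
        invFun p := (p.2 - p.1, p.2)
        left_inv p := by simp
        right_inv p := by simp }
    let e₂ : (ℤ × ℤ) × (ℤ × ℤ) ≃ (ℤ × ℤ) × (ℤ × ℤ) :=
      { toFun p := (p.2 - p.1, p.1)
        invFun p := (p.2, p.1 + p.2)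
        left_inv p := by simp
        right_inv p := by simp }
    -- AM–GM splits ‖g x‖‖f y‖ into squares; the two shears of the lattice turn each half into a
    -- convolution sum.
    have hS := ((e₁.hasSum_iff.2 (hprod g)).add (e₂.hasSum_iff.2 (hprod f))).div_const 2
    have hT : ∀ p : (ℤ × ℤ) × (ℤ × ℤ), ‖⟪g p.2, A (lp.single 2 p.1 (f p.1)) p.2⟫_ℂ‖ ≤
        (((fun q : (ℤ × ℤ) × (ℤ × ℤ) => b q.1 * ‖g q.2‖ ^ 2) ∘ e₁) p +
          ((fun q : (ℤ × ℤ) × (ℤ × ℤ) => b q.1 * ‖f q.2‖ ^ 2) ∘ e₂) p) / 2 := by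
      rintro ⟨y, x⟩
      have h1 : ‖A (lp.single 2 y (f y)) x‖ ≤ b (x - y) * ‖f y‖ :=
        ((kernel A x y).le_opNorm (f y)).trans (by gcongr; exact hA x y)
      have h2 := (norm_inner_le_norm (𝕜 := ℂ) (g x) (A (lp.single 2 y (f y)) x)).trans
        (mul_le_mul_of_nonneg_left h1 (norm_nonneg _))
      refine h2.trans ?_
      simp only [Function.comp, e₁, e₂, Equiv.coe_fn_mk]
      nlinarith [mul_nonneg (hb0 (x - y)) (sq_nonneg (‖g x‖ - ‖f y‖))]
    have hsum := (Summable.of_norm_bounded hS.summable hT).hasSum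
    have h1 := hsum.prod_fiberwise fun y => lp.hasSum_inner (𝕜 := ℂ) g (A (lp.single 2 y (f y)))
    have h2 := (innerSL ℂ g).hasSum (A.hasSum (hasSum_single f))
    have h3 := h1.unique h2
    rw [innerSL_apply_apply] at h3
    rw [← h3]
    refine (hsum.norm_le_of_bounded hS hT).trans (le_of_eq ?_)
    ring
  refine ContinuousLinearMap.opNorm_le_bound _ hB0 fun f => ?_
  by_cases hf : ‖A f‖ = 0
  · rw [hf]; positivity
  have hf0 : 0 < ‖A f‖ := lt_of_le_of_ne (norm_nonneg _) (Ne.symm hf)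
  have hf1 : 0 < ‖f‖ := by
    rw [norm_pos_iff]
    rintro rfl
    simp at hf
  -- The test vector is parallel to Af and has norm ‖f‖, so the AM–GM bound becomes B‖f‖².
  have h := key f (((‖f‖ / ‖A f‖ : ℝ) : ℂ) • A f)
  rw [inner_smul_left, norm_mul, inner_self_eq_norm_sq_to_K, norm_smul] at h
  simp only [Complex.conj_ofReal, Complex.norm_real, norm_div, norm_norm, norm_pow,
    Complex.coe_algebraMap] at h
  rw [div_mul_cancel₀ _ hf] at h
  have e : ‖f‖ / ‖A f‖ * ‖A f‖ ^ 2 = ‖f‖ * ‖A f‖ := by field_simp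
  rw [e] at h
  nlinarith

/-- Multiplication by a bounded real function on the lattice. -/
def diagOp (m : ℕ) (w : ℤ × ℤ → ℝ) {R : ℝ} (hR : 0 ≤ R) (hw : ∀ x, |w x| ≤ R) : Op m :=
  lp.mapCLM 2 (fun x : ℤ × ℤ => (w x : ℂ) • ContinuousLinearMap.id ℂ (EuclideanSpace ℂ (Fin m))) hR
    fun x => by
      rw [norm_smul, Complex.norm_real, Real.norm_eq_abs]
      exact (mul_le_of_le_one_right (abs_nonneg _) ContinuousLinearMap.norm_id_le).trans (hw x)

section

variable {w w' : ℤ × ℤ → ℝ} {R R' : ℝ} (hR : 0 ≤ R) (hw : ∀ x, |w x| ≤ R) (hR' : 0 ≤ R')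
  (hw' : ∀ x, |w' x| ≤ R')

theorem diagOp_apply (f : Hilb m) (x : ℤ × ℤ) : diagOp m w hR hw f x = (w x : ℂ) • f x := by
  rw [diagOp, lp.mapCLM_apply_coe]
  simp

theorem diagOp_mul_diagOp (h : ∀ x, w x * w' x = 1) :
    diagOp m w hR hw * diagOp m w' hR' hw' = 1 := by
  refine ContinuousLinearMap.ext fun f => lp.ext (funext fun x => ?_)
  rw [mul_apply_eq_comp, diagOp_apply, diagOp_apply, smul_smul, ← Complex.ofReal_mul, h]
  simp

theorem diagOp_single (y : ℤ × ℤ) (v : EuclideanSpace ℂ (Fin m)) :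
    diagOp m w hR hw (lp.single 2 y v) = (w y : ℂ) • lp.single 2 y v := by
  refine lp.ext (funext fun x => ?_)
  rw [diagOp_apply, lp.coeFn_smul, Pi.smul_apply]
  by_cases hxy : x = y
  · subst hxy; rfl
  · simp [hxy]

theorem kernel_diagOp_mul_mul (A : Op m) (x y : ℤ × ℤ) :
    kernel (diagOp m w hR hw * A * diagOp m w' hR' hw') x y =
      ((w x * w' y : ℝ) : ℂ) • kernel A x y := by
  ext1 v
  rw [kernel_apply, mul_apply_eq_comp, mul_apply_eq_comp, diagOp_apply, diagOp_single, map_smul,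
    lp.coeFn_smul, Pi.smul_apply, smul_smul, smul_apply, kernel_apply, Complex.ofReal_mul]

end

theorem kernel_sub (A B : Op m) (x y : ℤ × ℤ) : kernel (A - B) x y = kernel A x y - kernel B x y :=
  rfl

theorem abs_exp_sub_one_le_mul_exp (t : ℝ) : |Real.exp t - 1| ≤ |t| * Real.exp |t| := by
  rcases le_total 0 t with h | h
  · rw [abs_of_nonneg h, abs_of_nonneg (by linarith [Real.add_one_le_exp t])]
    have := Real.add_one_le_exp (-t)
    have h2 : Real.exp t * Real.exp (-t) = 1 := by rw [← Real.exp_add]; simp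
    nlinarith [Real.exp_pos t]
  · rw [abs_of_nonpos h, abs_of_nonpos (by linarith [Real.exp_le_one_iff.2 h])]
    nlinarith [Real.add_one_le_exp t, Real.one_le_exp (neg_nonneg.2 h)]

/-- A small exponential tilt changes an exponentially decaying kernel only a little. -/
theorem abs_exp_sub_one_mul_exp_neg_le {ν δ d s : ℝ} (hν : 0 < ν) (hδ : 0 ≤ δ) (hδν : δ ≤ ν / 4)
    (hd : 0 ≤ d) (hs : |s| ≤ d) :
    |Real.exp (δ * s) - 1| * Real.exp (-ν * d) ≤ δ * (4 / ν) * Real.exp (-(ν / 2) * d) := by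
  have h1 : |δ * s| ≤ δ * d := by
    rw [abs_mul, abs_of_nonneg hδ]
    gcongr
  have h2 : δ * d ≤ ν / 4 * d := by gcongr
  have h3 : d ≤ 4 / ν * Real.exp (ν / 4 * d) := by
    rw [div_mul_eq_mul_div, le_div_iff₀ hν]
    linarith [Real.add_one_le_exp (ν / 4 * d)]
  calc |Real.exp (δ * s) - 1| * Real.exp (-ν * d)
      ≤ |δ * s| * Real.exp |δ * s| * Real.exp (-ν * d) := by
        gcongr
        exact abs_exp_sub_one_le_mul_exp _
    _ ≤ δ * (4 / ν * Real.exp (ν / 4 * d)) * Real.exp (ν / 4 * d) * Real.exp (-ν * d) := by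
        gcongr
        · exact h1.trans (by gcongr)
        · exact h1.trans h2
    _ = δ * (4 / ν) * (Real.exp (ν / 4 * d) * Real.exp (ν / 4 * d) * Real.exp (-ν * d)) := by ring
    _ = _ := by
        rw [← Real.exp_add, ← Real.exp_add]
        ring_nf

/-- Combes–Thomas: conjugation by e^{δρ} multiplies the kernel by e^{δ(ρ(x) - ρ(y))}, so a bound on
the conjugated projection, uniform in the weight, is exponential decay of its kernel. -/
theorem isLocal_fermiProjection {H : Op m} {e : ℝ} (hH : IsSelfAdjoint H) (hloc : IsLocal H)
    (he : (e : ℂ) ∉ spectrum ℂ H) : IsLocal (fermiProjection H e) := by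
  obtain ⟨ε, C, hε, hC, hconj⟩ := exists_norm_conj_fermiProjection_le hH he
  obtain ⟨ν, hν, hker⟩ := hloc
  have hsum := summable_exp_neg_norm (half_pos hν)
  set S := ∑' x, Real.exp (-(ν / 2) * ‖latticePoint x‖) with hS
  have hS0 : 0 < S := hsum.tsum_pos (fun x => (Real.exp_pos _).le) 0 (Real.exp_pos _)
  set δ := min (ν / 4) (ε / (4 / ν * ν⁻¹ * S)) with hδ
  have hδ0 : 0 < δ := by positivity
  have hδε : δ * (4 / ν) * ν⁻¹ * S ≤ ε := by
    have := min_le_right (ν / 4) (ε / (4 / ν * ν⁻¹ * S))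
    rw [← hδ, le_div_iff₀ (by positivity)] at this
    linarith
  have hdecay : ∀ x y, ‖kernel (fermiProjection H e) x y‖ ≤
      C * Real.exp (-δ * ‖latticePoint x - latticePoint y‖) := by
    intro x₀ y₀
    set R := ‖latticePoint x₀ - latticePoint y₀‖ with hR
    have hR0 : 0 ≤ R := norm_nonneg _
    -- Truncation at R makes the weights bounded, keeps ρ 1-Lipschitz, and loses nothing at x₀,
    -- where ρ = R.
    let ρ : ℤ × ℤ → ℝ := fun x => min ‖latticePoint x - latticePoint y₀‖ R
    have hρ0 : ∀ x, 0 ≤ ρ x := fun x => le_min (norm_nonneg _) hR0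
    have hρR : ∀ x, ρ x ≤ R := fun x => min_le_right _ _
    have hρ : ∀ x y, |ρ x - ρ y| ≤ ‖latticePoint x - latticePoint y‖ := by
      intro x y
      refine (abs_min_sub_min_le_max _ _ _ _).trans ?_
      rw [sub_self, abs_zero, max_eq_left (abs_nonneg _)]
      refine (abs_norm_sub_norm_le _ _).trans (le_of_eq ?_)
      rw [sub_sub_sub_cancel_right]
    have hw : ∀ x, |Real.exp (δ * ρ x)| ≤ Real.exp (δ * R) := fun x => by
      rw [Real.abs_exp]
      gcongr
      exact hρR x
    have hw' : ∀ x, |Real.exp (-(δ * ρ x))| ≤ 1 := fun x => by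
      rw [Real.abs_exp, Real.exp_le_one_iff]
      have := mul_nonneg hδ0.le (hρ0 x)
      linarith
    set D := diagOp m _ (Real.exp_pos _).le hw with hD
    set D' := diagOp m _ zero_le_one hw' with hD'
    have hDD' : D * D' = 1 := diagOp_mul_diagOp _ _ _ _ fun x => by
      rw [← Real.exp_add, add_neg_cancel, Real.exp_zero]
    have hD'D : D' * D = 1 := diagOp_mul_diagOp _ _ _ _ fun x => by
      rw [← Real.exp_add, neg_add_cancel, Real.exp_zero]
    have hclose : ‖D * H * D' - H‖ ≤ ε := by
      refine (norm_le_tsum_of_norm_kernel_le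
        (b := fun x => δ * (4 / ν) * ν⁻¹ * Real.exp (-(ν / 2) * ‖latticePoint x‖))
        (hsum.mul_left _) fun x y => ?_).trans ?_
      · have e1 : kernel (D * H * D' - H) x y =
            ((Real.exp (δ * (ρ x - ρ y)) - 1 : ℝ) : ℂ) • kernel H x y := by
          rw [kernel_sub, hD, hD', kernel_diagOp_mul_mul, ← Real.exp_add,
            show δ * ρ x + -(δ * ρ y) = δ * (ρ x - ρ y) by ring]
          ext1 v
          rw [sub_apply, smul_apply, smul_apply, Complex.ofReal_sub, Complex.ofReal_one, sub_smul,
            one_smul]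
        rw [e1, norm_smul, Complex.norm_real, Real.norm_eq_abs, ← latticePoint_sub]
        have h1 := abs_exp_sub_one_mul_exp_neg_le hν hδ0.le (min_le_left _ _) (norm_nonneg _)
          (hρ x y)
        calc _ ≤ |Real.exp (δ * (ρ x - ρ y)) - 1| *
              (ν⁻¹ * Real.exp (-ν * ‖latticePoint x - latticePoint y‖)) := by
              gcongr
              exact hker x y
          _ = ν⁻¹ * (|Real.exp (δ * (ρ x - ρ y)) - 1| *
              Real.exp (-ν * ‖latticePoint x - latticePoint y‖)) := by ring
          _ ≤ ν⁻¹ * (δ * (4 / ν) *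
              Real.exp (-(ν / 2) * ‖latticePoint x - latticePoint y‖)) := by gcongr
          _ = _ := by ring
      · rw [tsum_mul_left]
        exact hδε
    have h1 := (norm_kernel_le _ x₀ y₀).trans (hconj D D' hD'D hDD' hclose)
    rw [hD, hD', kernel_diagOp_mul_mul, norm_smul, Complex.norm_real, ← Real.exp_add,
      Real.norm_eq_abs, Real.abs_exp] at h1
    have hx : ρ x₀ = R := min_self _
    have hy : ρ y₀ = 0 := by simp [ρ, hR0]
    rw [hx, hy, mul_zero, neg_zero, add_zero] at h1
    have h2 : Real.exp (δ * R) * Real.exp (-δ * R) = 1 := by rw [← Real.exp_add]; simp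
    calc _ = Real.exp (δ * R) * ‖kernel (fermiProjection H e) x₀ y₀‖ * Real.exp (-δ * R) := by
          rw [mul_right_comm, h2, one_mul]
      _ ≤ _ := by gcongr
  -- Locality uses one ν for both rate and prefactor, so ν must satisfy ν ≤ δ and ν⁻¹ ≥ C.
  refine ⟨min δ C⁻¹, by positivity, fun x y => (hdecay x y).trans ?_⟩
  gcongr
  · rw [le_inv_comm₀ hC (by positivity)]
    exact min_le_right _ _
  · exact min_le_left _ _

end FermiLocal

end GeometricHall

end

/-- First part: an arbitrary local (orthogonal) projection `P`. Second part: the Fermi projection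
of a local Hamiltonian `H` that is insulating at `EF`. -/
theorem mainTheorem4 (m : ℕ) (U V : Set GeometricHall.Plane)
    (hUV : GeometricHall.AreTransverse U V) :
    (∀ P : GeometricHall.Op m, IsStarProjection P → GeometricHall.IsLocal P →
      (GeometricHall.kitaevOp P U V).IsFredholm ∧
      GeometricHall.IsTraceClass (GeometricHall.hallOp P U V) ∧
      (GeometricHall.kitaevIndex P U V : ℂ) =
        2 * Real.pi * GeometricHall.hallConductance P U V) ∧
    (∀ (H : GeometricHall.Op m) (EF : ℝ), IsSelfAdjoint H → GeometricHall.IsLocal H →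
      (EF : ℂ) ∉ spectrum ℂ H →
      (GeometricHall.kitaevOp (GeometricHall.fermiProjection H EF) U V).IsFredholm ∧
      GeometricHall.IsTraceClass
        (GeometricHall.hallOp (GeometricHall.fermiProjection H EF) U V) ∧
      (GeometricHall.kitaevIndex (GeometricHall.fermiProjection H EF) U V : ℂ) =
        2 * Real.pi *
          GeometricHall.hallConductance (GeometricHall.fermiProjection H EF) U V) := by
  exact ⟨fun P hP hloc => GeometricHall.index_theorem_of_isLocal hUV hP hloc,
    fun H EF hH hloc he => GeometricHall.index_theorem_of_isLocal hUV
      (GeometricHall.isStarProjection_fermiProjection he)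
      (GeometricHall.isLocal_fermiProjection hH hloc he)⟩
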